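/- **Definitions.** The Kantorovich–Wasserstein distance of two probability measures $\mu,\nu$ on $\mathbb{R}$ is $$\mathcal{W}(\mu,\nu)=\sup\Big\{\Big|\int h\,d\mu-\int h\,d\nu\Big| : h:\mathbb{R}\to\mathbb{R}\ \text{Lipschitz with constant } 1\Big\}.$$ For a real random variable $W$ with finite second moment and $\mathrm{Var}(W)>0$, let $\delta_W=\mathcal{W}(\mu,\nu)$, where $\mu$ is the law of $(W-\mathbb{E}W)/\sqrt{\mathrm{Var}(W)}$ and $\nu$ is the standard Gaussian law. **Proposition 3.3.** There is a universal constant $C$ such that the following holds. Let $(\mathcal{X},\rho)$ be a separable metric space endowed with a nonnegative Borel measure $\lambda$, let $X_1,\dots,X_n$ be i.i.d. random points of $\mathcal{X}$, and let $\varepsilon>0$. Let $\mathcal{B}(u,\varepsilon)$ denote the closed ball of radius $\varepsilon$ centred at $u$, and put $$\mathcal{R}=\bigcup_{i=1}^n\mathcal{B}(X_i,\varepsilon),\qquad W=\lambda(\mathcal{R}),\qquad \sigma_\varepsilon^2=\mathrm{Var}(W),\qquad M_\varepsilon=\sup_{u\in\mathcal{X}}\lambda(\mathcal{B}(u,\varepsilon))\in[0,\infty],$$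 and let $p_\varepsilon=\mathbb{P}(\rho(X_1,X_2)\le 2\varepsilon)$ (for $n=1$, $X_2$ denotes an independent copy of $X_1$). Suppose that $0<\sigma_\varepsilon^2<\infty$. Then $$\delta_W\le\frac{C\,n^{1/2}M_\varepsilon^2(1+np_\varepsilon)}{\sigma_\varepsilon^2}+\frac{nM_\varepsilon^3}{2\sigma_\varepsilon^3}.$$ (If $M_\varepsilon=\infty$ the right-hand side is $\infty$; if $M_\varepsilon<\infty$ then $W\le nM_\varepsilon$ is bounded.) -/

import Mathlib

open MeasureTheory ProbabilityTheory
open scoped ENNReal NNReal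

noncomputable section

namespace CoverageCLT

/-- The Kantorovich–Wasserstein distance between two probability measures on the real line:
the supremum of `|∫ h dμ - ∫ h dν|` over all `1`-Lipschitz functions `h`, in `[0, ∞]`
(every such `h` is integrable when the two measures have finite first moments). -/
def wasserstein (μ ν : Measure ℝ) : ℝ≥0∞ :=
  ⨆ (h : ℝ → ℝ) (_ : LipschitzWith 1 h), ENNReal.ofReal |(∫ x, h x ∂μ) - ∫ x, h x ∂ν|

/-- The distance to Gaussianity `δ_W` of a real random variable `W`: the Kantorovich–Wasserstein
distance between the law of `(W - E W) / √Var(W)` and the standard Gaussian law. -/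
def gaussianDist {Ω : Type*} [MeasurableSpace Ω] (P : Measure Ω) (W : Ω → ℝ) : ℝ≥0∞ :=
  wasserstein (P.map fun ω => (W ω - ∫ ω', W ω' ∂P) / √(Var[W; P])) (gaussianReal 0 1)

section Coverage

variable {𝒳 : Type*} [MetricSpace 𝒳] [MeasurableSpace 𝒳]

/-- The region covered by the closed balls of radius `ε` centred at the points `x i`. -/
def coveredRegion {n : ℕ} (ε : ℝ) (x : Fin n → 𝒳) : Set 𝒳 :=
  ⋃ i, Metric.closedBall (x i) ε

/-- The random variable `W = l (⋃ i, B (X i, ε))`. -/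
def coveredVolume {Ω : Type*} {n : ℕ} (l : Measure 𝒳) (ε : ℝ) (X : Fin n → Ω → 𝒳) (ω : Ω) : ℝ :=
  (l (coveredRegion ε fun i => X i ω)).toReal

/-- `M_ε = sup_u l (B (u, ε))`, a value in `[0, ∞]`. -/
def maxBall (l : Measure 𝒳) (ε : ℝ) : ℝ≥0∞ :=
  ⨆ u : 𝒳, l (Metric.closedBall u ε)

/-- `p_ε`: the probability that two independent points with law `ν` are within distance `2 ε`. -/
def closeProb (ν : Measure 𝒳) (ε : ℝ) : ℝ≥0∞ :=
  (ν.prod ν) {q : 𝒳 × 𝒳 | dist q.1 q.2 ≤ 2 * ε}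

end Coverage

end CoverageCLT

end

/-! The proof is Stein's method combined with resampling. For a 1-Lipschitz `h`, the equation f'(x)
- x f(x) = h(x) - E h(Z), with Z standard Gaussian, has a solution whose derivative is bounded by 4
and 2-Lipschitz (`exists_stein_solution`). It remains to compare E f'(w) with E w f(w), where w = (W
- m)/σ and m = E W.

Replacing the sample points one by one by independent copies telescopes the covariance of f(w) and W
(`covariance_eq_sum_resampling`) into a sum over j of E [f(w) - f(w - d_j/σ)] D_j. Here d_j is the
volume covered by ball j alone, and D_j is the change of that volume when point j is resampled in
the partly replaced sample. Taylor expansion turns the bracket into f'(w) d_j/σ. The error,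
controlled by d_j ≤ M and E|D_j| ≤ M/2, sums to the M³ term.

What is left is E f'(w) T with T = Σ d_j D_j, and E T = σ². Changing one pair (point, copy) moves T
by at most 14 M² (`abs_varStat_sub_update_le`): in each of the three families of exposed volumes,
the other balls gain or lose exposure in disjoint regions, all inside four balls
(`sum_abs_exposed_sub_le`). Efron–Stein then gives E|T - σ²| ≤ 14 √n M². Neighbours are never
counted, so this argument yields the bound even without the factor 1 + n p_ε. -/

namespace CoverageCLT

/-! ### Stein's equation for the Gaussian law -/

section Stein

open Set Filter Topology

/-- The standard Gaussian density. -/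
local notation "φ" => gaussianPDFReal 0 1

lemma stdGaussianPDF_eq (x : ℝ) : φ x = (√(2 * Real.pi))⁻¹ * Real.exp (-(1 / 2) * x ^ 2) := by
  simp only [gaussianPDFReal, NNReal.coe_one, mul_one, sub_zero]
  congr 2
  ring

lemma stdGaussianPDF_pos (x : ℝ) : 0 < φ x := gaussianPDFReal_pos 0 1 x one_ne_zero

lemma hasDerivAt_stdGaussianPDF (x : ℝ) : HasDerivAt φ (-(x * φ x)) x := by
  have h : φ = fun x => (√(2 * Real.pi))⁻¹ * Real.exp (-(1 / 2) * x ^ 2) :=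
    funext stdGaussianPDF_eq
  rw [stdGaussianPDF_eq, h]
  have := ((((hasDerivAt_id x).pow 2).const_mul (-(1 / 2) : ℝ)).exp).const_mul
    ((√(2 * Real.pi))⁻¹)
  refine HasDerivAt.congr_deriv this ?_
  simp
  ring

lemma continuous_stdGaussianPDF : Continuous φ :=
  continuous_iff_continuousAt.2 fun x => (hasDerivAt_stdGaussianPDF x).continuousAt

lemma integrable_stdGaussianPDF : Integrable φ := integrable_gaussianPDFReal 0 1

lemma integrable_id_mul_stdGaussianPDF : Integrable fun x => x * φ x := by
  have := (integrable_mul_exp_neg_mul_sq (b := 1 / 2) (by norm_num)).const_mul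
    ((√(2 * Real.pi))⁻¹)
  refine this.congr (ae_of_all _ fun x => ?_)
  simp only [stdGaussianPDF_eq]
  ring

lemma integrable_sq_mul_stdGaussianPDF : Integrable fun x => x ^ 2 * φ x := by
  have := (integrable_rpow_mul_exp_neg_mul_sq (b := 1 / 2) (by norm_num)
    (s := 2) (by norm_num)).const_mul ((√(2 * Real.pi))⁻¹)
  refine this.congr (ae_of_all _ fun x => ?_)
  simp only [stdGaussianPDF_eq, Real.rpow_two]
  ring

lemma hasDerivAt_neg_stdGaussianPDF (x : ℝ) : HasDerivAt (fun x => -φ x) (x * φ x) x := by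
  exact (hasDerivAt_stdGaussianPDF x).neg.congr_deriv (neg_neg _)

lemma hasDerivAt_neg_id_mul_stdGaussianPDF (x : ℝ) :
    HasDerivAt (fun x => -(x * φ x)) (x ^ 2 * φ x - φ x) x := by
  refine ((hasDerivAt_id x).mul (hasDerivAt_stdGaussianPDF x)).neg.congr_deriv ?_
  simp
  ring

lemma integral_Iic_id_mul_stdGaussianPDF (w : ℝ) : ∫ t in Iic w, t * φ t = -φ w := by
  have h := tendsto_zero_of_hasDerivAt_of_integrableOn_Iic (a := w)
    (fun x _ => hasDerivAt_neg_stdGaussianPDF x) integrable_id_mul_stdGaussianPDF.integrableOn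
    integrable_stdGaussianPDF.neg.integrableOn
  simpa using integral_Iic_of_hasDerivAt_of_tendsto'
    (fun x _ => hasDerivAt_neg_stdGaussianPDF x) integrable_id_mul_stdGaussianPDF.integrableOn h

lemma integral_Ioi_id_mul_stdGaussianPDF (w : ℝ) : ∫ t in Ioi w, t * φ t = φ w := by
  have h := tendsto_zero_of_hasDerivAt_of_integrableOn_Ioi (a := w)
    (fun x _ => hasDerivAt_neg_stdGaussianPDF x) integrable_id_mul_stdGaussianPDF.integrableOn
    integrable_stdGaussianPDF.neg.integrableOn
  simpa using integral_Ioi_of_hasDerivAt_of_tendsto'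
    (fun x _ => hasDerivAt_neg_stdGaussianPDF x) integrable_id_mul_stdGaussianPDF.integrableOn h

lemma integral_Iic_sq_mul_stdGaussianPDF (w : ℝ) :
    ∫ t in Iic w, t ^ 2 * φ t = (∫ t in Iic w, φ t) - w * φ w := by
  have hi := (integrable_sq_mul_stdGaussianPDF.sub integrable_stdGaussianPDF).integrableOn
    (s := Iic w)
  have h := tendsto_zero_of_hasDerivAt_of_integrableOn_Iic (a := w)
    (fun x _ => hasDerivAt_neg_id_mul_stdGaussianPDF x) hi
    integrable_id_mul_stdGaussianPDF.neg.integrableOn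
  have := integral_Iic_of_hasDerivAt_of_tendsto'
    (fun x _ => hasDerivAt_neg_id_mul_stdGaussianPDF x) hi h
  rw [integral_sub integrable_sq_mul_stdGaussianPDF.integrableOn
    integrable_stdGaussianPDF.integrableOn] at this
  linarith

lemma integral_Ioi_sq_mul_stdGaussianPDF (w : ℝ) :
    ∫ t in Ioi w, t ^ 2 * φ t = (∫ t in Ioi w, φ t) + w * φ w := by
  have hi := (integrable_sq_mul_stdGaussianPDF.sub integrable_stdGaussianPDF).integrableOn
    (s := Ioi w)
  have h := tendsto_zero_of_hasDerivAt_of_integrableOn_Ioi (a := w)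
    (fun x _ => hasDerivAt_neg_id_mul_stdGaussianPDF x) hi
    integrable_id_mul_stdGaussianPDF.neg.integrableOn
  have := integral_Ioi_of_hasDerivAt_of_tendsto'
    (fun x _ => hasDerivAt_neg_id_mul_stdGaussianPDF x) hi h
  rw [integral_sub integrable_sq_mul_stdGaussianPDF.integrableOn
    integrable_stdGaussianPDF.integrableOn] at this
  linarith

lemma setIntegral_sq_sub_mul_stdGaussianPDF (w : ℝ) (s : Set ℝ) :
    ∫ t in s, (t - w) ^ 2 * φ t
      = (∫ t in s, t ^ 2 * φ t) - 2 * w * (∫ t in s, t * φ t) + w ^ 2 * ∫ t in s, φ t := by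
  rw [← integral_const_mul, ← integral_const_mul, ← integral_sub, ← integral_add]
  · congr with t
    ring
  · exact (integrable_sq_mul_stdGaussianPDF.sub
      (integrable_id_mul_stdGaussianPDF.const_mul _)).integrableOn
  · exact (integrable_stdGaussianPDF.const_mul _).integrableOn
  · exact integrable_sq_mul_stdGaussianPDF.integrableOn
  · exact (integrable_id_mul_stdGaussianPDF.const_mul _).integrableOn

/-- Expanding the nonnegative integral of (t - w)² φ(t) over the tail gives this Mills-ratio bound
for every real w. -/
lemma mills_lower (w : ℝ) : w * φ w ≤ (1 + w ^ 2) * ∫ t in Ioi w, φ t := by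
  have h : 0 ≤ ∫ t in Ioi w, (t - w) ^ 2 * φ t :=
    integral_nonneg fun t => mul_nonneg (sq_nonneg _) (stdGaussianPDF_pos t).le
  rw [setIntegral_sq_sub_mul_stdGaussianPDF, integral_Ioi_sq_mul_stdGaussianPDF,
    integral_Ioi_id_mul_stdGaussianPDF] at h
  linarith

lemma mills_lower_left (w : ℝ) : -(w * φ w) ≤ (1 + w ^ 2) * ∫ t in Iic w, φ t := by
  have h : 0 ≤ ∫ t in Iic w, (t - w) ^ 2 * φ t :=
    integral_nonneg fun t => mul_nonneg (sq_nonneg _) (stdGaussianPDF_pos t).le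
  rw [setIntegral_sq_sub_mul_stdGaussianPDF, integral_Iic_sq_mul_stdGaussianPDF,
    integral_Iic_id_mul_stdGaussianPDF] at h
  linarith

lemma integral_Iic_add_Ioi_stdGaussianPDF (w : ℝ) :
    (∫ t in Iic w, φ t) + ∫ t in Ioi w, φ t = 1 := by
  rw [intervalIntegral.integral_Iic_add_Ioi integrable_stdGaussianPDF.integrableOn
    integrable_stdGaussianPDF.integrableOn]
  exact integral_gaussianPDFReal_eq_one 0 one_ne_zero

variable {h : ℝ → ℝ}

lemma integrable_lipschitz_mul_stdGaussianPDF (hh : LipschitzWith 1 h) :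
    Integrable fun t => h t * φ t := by
  have hb : Integrable fun t => |h 0| * φ t + |t * φ t| :=
    (integrable_stdGaussianPDF.const_mul _).add integrable_id_mul_stdGaussianPDF.abs
  refine hb.mono' (hh.continuous.mul continuous_stdGaussianPDF).aestronglyMeasurable
    (ae_of_all _ fun t => ?_)
  have h1 := hh.dist_le_mul t 0
  rw [Real.dist_eq, Real.dist_eq] at h1
  have h2 : |h t| ≤ |h 0| + |t| := by
    have := abs_sub_abs_le_abs_sub (h t) (h 0)
    simp at h1
    linarith
  rw [Real.norm_eq_abs, abs_mul, abs_mul, abs_of_pos (stdGaussianPDF_pos t), ← add_mul]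
  exact mul_le_mul_of_nonneg_right h2 (stdGaussianPDF_pos t).le

/-- The Lipschitz bound |h t - h w| ≤ w - t reduces the claim to zeroth and first partial moments of
φ. -/
lemma abs_integral_Iic_lipschitz_le (hh : LipschitzWith 1 h) (w : ℝ) :
    |∫ t in Iic w, (h t - h w) * φ t| ≤ w * (∫ t in Iic w, φ t) + φ w := by
  have hi : IntegrableOn (fun t => w * φ t - t * φ t) (Iic w) :=
    ((integrable_stdGaussianPDF.const_mul w).sub integrable_id_mul_stdGaussianPDF).integrableOn
  have : w * (∫ t in Iic w, φ t) + φ w = ∫ t in Iic w, (w * φ t - t * φ t) := by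
    rw [integral_sub (integrable_stdGaussianPDF.const_mul w).integrableOn
      integrable_id_mul_stdGaussianPDF.integrableOn, integral_const_mul,
      integral_Iic_id_mul_stdGaussianPDF]
    ring
  rw [this, ← Real.norm_eq_abs]
  refine norm_integral_le_of_norm_le hi ?_
  filter_upwards [ae_restrict_mem measurableSet_Iic] with t ht
  have h1 := hh.dist_le_mul t w
  rw [Real.dist_eq, Real.dist_eq, abs_of_nonpos (sub_nonpos.2 (mem_Iic.1 ht))] at h1
  rw [Real.norm_eq_abs, abs_mul, abs_of_pos (stdGaussianPDF_pos t), ← sub_mul]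
  refine mul_le_mul_of_nonneg_right ?_ (stdGaussianPDF_pos t).le
  simpa using h1

lemma abs_integral_Ioi_lipschitz_le (hh : LipschitzWith 1 h) (w : ℝ) :
    |∫ t in Ioi w, (h t - h w) * φ t| ≤ φ w - w * (∫ t in Ioi w, φ t) := by
  have hi : IntegrableOn (fun t => t * φ t - w * φ t) (Ioi w) :=
    (integrable_id_mul_stdGaussianPDF.sub (integrable_stdGaussianPDF.const_mul w)).integrableOn
  have : φ w - w * (∫ t in Ioi w, φ t) = ∫ t in Ioi w, (t * φ t - w * φ t) := by
    rw [integral_sub integrable_id_mul_stdGaussianPDF.integrableOn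
      (integrable_stdGaussianPDF.const_mul w).integrableOn, integral_const_mul,
      integral_Ioi_id_mul_stdGaussianPDF]
  rw [this, ← Real.norm_eq_abs]
  refine norm_integral_le_of_norm_le hi ?_
  filter_upwards [ae_restrict_mem measurableSet_Ioi] with t ht
  have h1 := hh.dist_le_mul t w
  rw [Real.dist_eq, Real.dist_eq, abs_of_pos (sub_pos.2 (mem_Ioi.1 ht))] at h1
  rw [Real.norm_eq_abs, abs_mul, abs_of_pos (stdGaussianPDF_pos t), ← sub_mul]
  refine mul_le_mul_of_nonneg_right ?_ (stdGaussianPDF_pos t).le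
  simpa using h1

/-- The solution of the Stein equation with right-hand side `h - c`. -/
noncomputable def steinSolution (h : ℝ → ℝ) (c w : ℝ) : ℝ :=
  (∫ t in Iic w, (h t - c) * gaussianPDFReal 0 1 t) / gaussianPDFReal 0 1 w

lemma hasDerivAt_steinSolution (hh : LipschitzWith 1 h) (c w : ℝ) :
    HasDerivAt (steinSolution h c) (w * steinSolution h c w + (h w - c)) w := by
  have hint : Integrable fun t => (h t - c) * φ t := by
    simp_rw [sub_mul]
    exact (integrable_lipschitz_mul_stdGaussianPDF hh).sub (integrable_stdGaussianPDF.const_mul c)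
  have hcont : Continuous fun t => (h t - c) * φ t :=
    (hh.continuous.sub continuous_const).mul continuous_stdGaussianPDF
  have hd : HasDerivAt (fun w => ∫ t in Iic w, (h t - c) * φ t) ((h w - c) * φ w) w := by
    have h1 : (fun w => ∫ t in Iic w, (h t - c) * φ t)
        = fun w => (∫ t in Iic 0, (h t - c) * φ t) + ∫ t in (0)..w, (h t - c) * φ t := by
      funext w
      rw [← intervalIntegral.integral_Iic_sub_Iic hint.integrableOn hint.integrableOn]
      ring
    rw [h1]
    exact (intervalIntegral.integral_hasDerivAt_right (hcont.intervalIntegrable _ _)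
      hcont.stronglyMeasurable.stronglyMeasurableAtFilter hcont.continuousAt).const_add _
  have hp := (stdGaussianPDF_pos w).ne'
  refine (hd.div (hasDerivAt_stdGaussianPDF w) hp).congr_deriv ?_
  unfold steinSolution
  field_simp
  ring

/-- Recentring at h w expresses both the mean of h and the solution through increments of h on
either side of w, where the Lipschitz condition applies. -/
lemma steinSolution_formula (hh : LipschitzWith 1 h) (w : ℝ) :
    (∫ x, h x ∂gaussianReal 0 1) - h w = (∫ t in Iic w, (h t - h w) * φ t)
        + ∫ t in Ioi w, (h t - h w) * φ t ∧
    φ w * steinSolution h (∫ x, h x ∂gaussianReal 0 1) w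
      = (∫ t in Iic w, (h t - h w) * φ t) * (∫ t in Ioi w, φ t)
        - (∫ t in Ioi w, (h t - h w) * φ t) * (∫ t in Iic w, φ t) := by
  have hint := integrable_lipschitz_mul_stdGaussianPDF hh
  have hS := integral_Iic_add_Ioi_stdGaussianPDF w
  have hc : ∫ x, h x ∂gaussianReal 0 1 = (∫ t in Iic w, h t * φ t) + ∫ t in Ioi w, h t * φ t := by
    rw [intervalIntegral.integral_Iic_add_Ioi hint.integrableOn hint.integrableOn,
      integral_gaussianReal_eq_integral_smul one_ne_zero]
    simp_rw [smul_eq_mul, mul_comm]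
  have hsub : ∀ (s : Set ℝ) (a : ℝ),
      ∫ t in s, (h t - a) * φ t = (∫ t in s, h t * φ t) - a * ∫ t in s, φ t := by
    intro s a
    simp_rw [sub_mul]
    rw [integral_sub hint.integrableOn (integrable_stdGaussianPDF.const_mul a).integrableOn,
      integral_const_mul]
  have hB : ∫ t in Ioi w, φ t = 1 - ∫ t in Iic w, φ t := by linarith
  unfold steinSolution
  rw [mul_div_cancel₀ _ (stdGaussianPDF_pos w).ne', hsub, hsub, hsub, hc, hB]
  constructor <;> ring

lemma abs_mul_add_mul_le {a b u v p q : ℝ} (ha : |a| ≤ p) (hb : |b| ≤ q) (hu : 0 ≤ u)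
    (hv : 0 ≤ v) : |a * u - b * v| ≤ p * u + q * v := by
  rw [abs_le] at *
  constructor <;> nlinarith

/-- The derivative of `w f(w)` for the solution `f` of the Stein equation is at most one. -/
lemma abs_deriv_id_mul_steinSolution_le (hh : LipschitzWith 1 h) (w : ℝ) :
    |steinSolution h (∫ x, h x ∂gaussianReal 0 1) w
      + w * (w * steinSolution h (∫ x, h x ∂gaussianReal 0 1) w
        + (h w - ∫ x, h x ∂gaussianReal 0 1))| ≤ 1 := by
  obtain ⟨h1, h2⟩ := steinSolution_formula hh w
  have hS := integral_Iic_add_Ioi_stdGaussianPDF w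
  have hA := abs_integral_Iic_lipschitz_le hh w
  have hB := abs_integral_Ioi_lipschitz_le hh w
  have hm := mills_lower w
  have hm' := mills_lower_left w
  have hp := stdGaussianPDF_pos w
  set c := ∫ x, h x ∂gaussianReal 0 1
  set f := steinSolution h c w
  set p := φ w
  set A := ∫ t in Iic w, φ t
  set B := ∫ t in Ioi w, φ t
  set a := ∫ t in Iic w, (h t - h w) * φ t
  set b := ∫ t in Ioi w, (h t - h w) * φ t
  have key := abs_mul_add_mul_le hA hB (sub_nonneg.2 hm) (sub_nonneg.2 hm')
  -- The coefficients of a and -b are nonnegative by the two Mills bounds, so the worst case takes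
  -- |a| and |b| maximal; that extremal value is exactly p (A + B) = p.
  have e1 : p * (f + w * (w * f + (h w - c)))
      = a * ((1 + w ^ 2) * B - w * p) - b * ((1 + w ^ 2) * A - -(w * p)) := by
    linear_combination (1 + w ^ 2) * h2 - w * p * h1
  have e2 : (w * A + p) * ((1 + w ^ 2) * B - w * p) + (p - w * B) * ((1 + w ^ 2) * A - -(w * p))
      = p := by
    linear_combination p * hS
  rw [← e1, e2, abs_mul, abs_of_pos hp] at key
  exact le_of_mul_le_mul_left (by linarith) hp

lemma stdGaussianPDF_le_one (w : ℝ) : φ w ≤ 1 := by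
  rw [stdGaussianPDF_eq]
  refine mul_le_one₀ ?_ (Real.exp_pos _).le (Real.exp_le_one_iff.2 (by nlinarith [sq_nonneg w]))
  refine inv_le_one_of_one_le₀ (Real.one_le_sqrt.2 ?_)
  linarith [Real.pi_gt_three]

/-- Here q and r are the two partial moments in the bound for f', with q the one on the tail side.
It decays like p/(1 + w²), while r = q + w grows only linearly. -/
lemma one_add_div_bound {q r w p : ℝ} (hp1 : p ≤ 1) (hq : 0 ≤ q)
    (hqp : q * (1 + w ^ 2) ≤ p) (hr : r = q + w) : r * q ≤ 2 * p := by
  have hqp' : q ≤ p := by nlinarith [mul_nonneg hq (sq_nonneg w)]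
  have h1 : r ≤ 2 * (1 + w ^ 2) := by nlinarith [sq_nonneg (w - 1)]
  calc r * q ≤ 2 * (1 + w ^ 2) * q := mul_le_mul_of_nonneg_right h1 hq
    _ ≤ 2 * p := by linarith

/-- The formula for f' gives φ|f'| ≤ 2PQ with P = wA + φ and Q = φ - wB, where A and B are the
Gaussian masses left and right of w, and PQ ≤ 2φ. -/
lemma abs_deriv_steinSolution_le (hh : LipschitzWith 1 h) (w : ℝ) :
    |w * steinSolution h (∫ x, h x ∂gaussianReal 0 1) w
        + (h w - ∫ x, h x ∂gaussianReal 0 1)| ≤ 4 := by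
  obtain ⟨h1, h2⟩ := steinSolution_formula hh w
  have hS := integral_Iic_add_Ioi_stdGaussianPDF w
  have hA := abs_integral_Iic_lipschitz_le hh w
  have hB := abs_integral_Ioi_lipschitz_le hh w
  have hm := mills_lower w
  have hm' := mills_lower_left w
  have hp := stdGaussianPDF_pos w
  have hp1 := stdGaussianPDF_le_one w
  set c := ∫ x, h x ∂gaussianReal 0 1
  set f := steinSolution h c w
  set p := φ w
  set A := ∫ t in Iic w, φ t
  set B := ∫ t in Ioi w, φ t
  set a := ∫ t in Iic w, (h t - h w) * φ t
  set b := ∫ t in Ioi w, (h t - h w) * φ t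
  have hP : 0 ≤ w * A + p := (abs_nonneg _).trans hA
  have hQ : 0 ≤ p - w * B := (abs_nonneg _).trans hB
  have key := abs_mul_add_mul_le (a := -a) ((abs_neg a).trans_le hA) hB hQ hP
  have e1 : p * (w * f + (h w - c)) = -a * (p - w * B) - b * (w * A + p) := by
    linear_combination w * h2 - p * h1
  have hPQ : (w * A + p) * (p - w * B) ≤ 2 * p := by
    rcases le_total 0 w with hw | hw
    · refine one_add_div_bound hp1 hQ ?_ (by linear_combination w * hS)
      nlinarith [mul_le_mul_of_nonneg_left hm hw]
    · rw [mul_comm]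
      refine one_add_div_bound (w := -w) hp1 hP ?_
        (by linear_combination -w * hS)
      nlinarith [mul_le_mul_of_nonneg_left hm' (neg_nonneg.2 hw)]
  rw [← e1, abs_mul, abs_of_pos hp] at key
  exact le_of_mul_le_mul_left (by nlinarith) hp

/-- In f'(x) = x f(x) + h(x) - c both x f(x) and h are 1-Lipschitz. No second derivative of f is
used, since h need not be differentiable. -/
lemma lipschitz_deriv_steinSolution (hh : LipschitzWith 1 h) (x y : ℝ) :
    |(x * steinSolution h (∫ x, h x ∂gaussianReal 0 1) x + (h x - ∫ x, h x ∂gaussianReal 0 1))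
      - (y * steinSolution h (∫ x, h x ∂gaussianReal 0 1) y
        + (h y - ∫ x, h x ∂gaussianReal 0 1))| ≤ 2 * |x - y| := by
  set c := ∫ x, h x ∂gaussianReal 0 1
  have h1 : |x * steinSolution h c x - y * steinSolution h c y| ≤ 1 * |x - y| := by
    have hd : ∀ w, HasDerivAt (fun w => w * steinSolution h c w)
        (steinSolution h c w + w * (w * steinSolution h c w + (h w - c))) w := by
      intro w
      refine ((hasDerivAt_id w).mul (hasDerivAt_steinSolution hh c w)).congr_deriv ?_
      simp
    have := Convex.norm_image_sub_le_of_norm_hasDerivWithin_le (C := 1)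
      (fun w _ => (hd w).hasDerivWithinAt)
      (fun w _ => abs_deriv_id_mul_steinSolution_le hh w) convex_univ (mem_univ y) (mem_univ x)
    simpa [Real.norm_eq_abs] using this
  have h2 := hh.dist_le_mul x y
  rw [Real.dist_eq, Real.dist_eq] at h2
  have h3 := abs_add_le (x * steinSolution h c x - y * steinSolution h c y) (h x - h y)
  simp only [NNReal.coe_one] at h2
  calc _ = |x * steinSolution h c x - y * steinSolution h c y + (h x - h y)| := by
        congr 1; ring
    _ ≤ _ := by linarith

/-- First order Taylor estimate for a function with Lipschitz derivative. -/
lemma abs_taylor_le_of_lipschitz_deriv {f f' : ℝ → ℝ} (hf : ∀ x, HasDerivAt f (f' x) x)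
    (hl : ∀ x y, |f' x - f' y| ≤ 2 * |x - y|) (x d : ℝ) (hd : 0 ≤ d) :
    |f x - f (x - d) - f' x * d| ≤ d ^ 2 := by
  -- With s = 1 and s = -1 this function treats both signs of the remainder; the Lipschitz bound on
  -- f' makes it nondecreasing for t ≥ 0.
  have hg : ∀ s : ℝ, |s| ≤ 1 → ∀ t, HasDerivAt
      (fun t => t ^ 2 + s * (f x - f (x - t) - f' x * t)) (2 * t + s * (f' (x - t) - f' x)) t := by
    intro s _ t
    have h1 : HasDerivAt (fun t => f (x - t)) (-f' (x - t)) t := by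
      simpa using (hf (x - t)).comp_const_sub x t
    refine (((hasDerivAt_id t).pow 2).add
      (((h1.const_sub (f x)).sub ((hasDerivAt_id t).const_mul (f' x))).const_mul s)).congr_deriv ?_
    simp
  have key : ∀ s : ℝ, |s| ≤ 1 → 0 ≤ d ^ 2 + s * (f x - f (x - d) - f' x * d) := by
    intro s hs
    have hmono : MonotoneOn (fun t => t ^ 2 + s * (f x - f (x - t) - f' x * t)) (Ici 0) := by
      refine monotoneOn_of_deriv_nonneg (convex_Ici 0)
        (fun t _ => (hg s hs t).continuousAt.continuousWithinAt)
        (fun t _ => (hg s hs t).differentiableAt.differentiableWithinAt) fun t ht => ?_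
      rw [interior_Ici] at ht
      rw [(hg s hs t).deriv]
      have h1 := hl (x - t) x
      rw [show x - t - x = -t by ring, abs_neg, abs_of_pos (mem_Ioi.1 ht)] at h1
      have h2 : |s * (f' (x - t) - f' x)| ≤ 2 * t := by
        rw [abs_mul]
        exact (mul_le_of_le_one_left (abs_nonneg _) hs).trans h1
      linarith [neg_abs_le (s * (f' (x - t) - f' x))]
    simpa using hmono (mem_Ici.2 le_rfl) (mem_Ici.2 hd) hd
  rw [abs_le]
  constructor
  · linarith [key 1 (by simp)]
  · linarith [key (-1) (by simp)]

/-- Stein's equation for a Lipschitz function, with bounds on the solution. -/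
lemma exists_stein_solution (hh : LipschitzWith 1 h) :
    ∃ f f' : ℝ → ℝ, Continuous f ∧ Continuous f' ∧
      (∀ x, h x - ∫ x, h x ∂gaussianReal 0 1 = f' x - x * f x) ∧ (∀ x, |f' x| ≤ 4) ∧
      ∀ x d, 0 ≤ d → |f x - f (x - d) - f' x * d| ≤ d ^ 2 := by
  have hc : Continuous (steinSolution h (∫ x, h x ∂gaussianReal 0 1)) :=
    continuous_iff_continuousAt.2 fun x => (hasDerivAt_steinSolution hh _ x).continuousAt
  refine ⟨steinSolution h (∫ x, h x ∂gaussianReal 0 1), fun x =>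
    x * steinSolution h (∫ x, h x ∂gaussianReal 0 1) x + (h x - ∫ x, h x ∂gaussianReal 0 1),
    hc, ?_, fun x => by ring, abs_deriv_steinSolution_le hh,
    abs_taylor_le_of_lipschitz_deriv (hasDerivAt_steinSolution hh _)
      (lipschitz_deriv_steinSolution hh)⟩
  exact (continuous_id.mul hc).add (hh.continuous.sub continuous_const)

end Stein

/-! ### Resampling on product spaces -/

section Resampling

variable {α : Type*} {n : ℕ}

/-- From a vector of pairs, take the second entries before position `j`, the first ones after. -/
def mix (j : ℕ) (y : Fin n → α × α) : Fin n → α := fun k => if (k : ℕ) < j then (y k).2 else (y k).1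

/-- Exchange the two entries of the pair at position `j`. -/
def swapAt (j : Fin n) (y : Fin n → α × α) : Fin n → α × α :=
  fun k => if k = j then (y k).swap else y k

lemma mix_zero_swapAt_of_ne (j : Fin n) (y : Fin n → α × α) {k : Fin n} (hk : k ≠ j) :
    mix 0 (swapAt j y) k = mix 0 y k := by
  simp [mix, swapAt, hk]

lemma mix_swapAt (j : Fin n) (y : Fin n → α × α) : mix j (swapAt j y) = mix (j + 1) y := by
  funext k
  by_cases hk : k = j
  · subst hk; simp [mix, swapAt]
  · have : (k : ℕ) ≠ j := fun h => hk (Fin.ext h)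
    have h2 : (k : ℕ) < j + 1 ↔ (k : ℕ) < j := by omega
    simp [mix, swapAt, hk, h2]

lemma mix_succ_swapAt (j : Fin n) (y : Fin n → α × α) : mix (j + 1) (swapAt j y) = mix j y := by
  funext k
  by_cases hk : k = j
  · subst hk; simp [mix, swapAt]
  · have : (k : ℕ) ≠ j := fun h => hk (Fin.ext h)
    have h2 : (k : ℕ) < j + 1 ↔ (k : ℕ) < j := by omega
    simp [mix, swapAt, hk, h2]

lemma mix_succ_eq_update (j : Fin n) (y : Fin n → α × α) :
    mix (j + 1) y = Function.update (mix j y) j (y j).2 := by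
  funext k
  by_cases hk : k = j
  · subst hk; simp [mix]
  · have : (k : ℕ) ≠ j := fun h => hk (Fin.ext h)
    have h2 : (k : ℕ) < j + 1 ↔ (k : ℕ) < j := by omega
    simp [mix, hk, h2]

variable [MeasurableSpace α] (μ : Measure α) [IsProbabilityMeasure μ]

lemma measurePreserving_mix (j : ℕ) :
    MeasurePreserving (mix (n := n) (α := α) j) (Measure.pi fun _ => μ.prod μ)
      (Measure.pi fun _ => μ) := by
  refine measurePreserving_pi (fun _ : Fin n => μ.prod μ) (fun _ => μ)
    (f := fun k p => if (k : ℕ) < j then p.2 else p.1) fun k => ?_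
  by_cases hk : (k : ℕ) < j
  · simpa [hk] using measurePreserving_snd
  · simpa [hk] using measurePreserving_fst

lemma measurePreserving_swapAt (j : Fin n) :
    MeasurePreserving (swapAt (α := α) j) (Measure.pi fun _ => μ.prod μ)
      (Measure.pi fun _ => μ.prod μ) := by
  refine measurePreserving_pi (fun _ : Fin n => μ.prod μ) (fun _ => μ.prod μ)
    (f := fun k p => if k = j then p.swap else p) fun k => ?_
  by_cases hk : k = j
  · simpa [hk] using! Measure.measurePreserving_swap
  · simpa [hk] using! MeasurePreserving.id _

lemma measurable_mix (j : ℕ) : Measurable (mix (n := n) (α := α) j) := by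
  refine measurable_pi_iff.2 fun k => ?_
  unfold mix
  by_cases hk : (k : ℕ) < j <;> simp only [hk, if_true, if_false] <;> fun_prop

lemma integral_comp_mix (j : ℕ) {F : (Fin n → α) → ℝ} (hF : Measurable F) :
    ∫ y, F (mix j y) ∂Measure.pi (fun _ => μ.prod μ) = ∫ x, F x ∂Measure.pi fun _ => μ := by
  rw [← (measurePreserving_mix μ j).map_eq,
    integral_map (measurable_mix j).aemeasurable hF.aestronglyMeasurable]

/-- At the two ends of the interpolation only first entries, respectively only second entries, are
used, and these are independent. -/
lemma integral_mix_zero_mul_mix {F G : (Fin n → α) → ℝ} :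
    ∫ y, F (mix 0 y) * G (mix n y) ∂Measure.pi (fun _ => μ.prod μ)
      = (∫ x, F x ∂Measure.pi fun _ => μ) * ∫ x, G x ∂Measure.pi fun _ => μ := by
  rw [← integral_prod_mul,
    ← (measurePreserving_arrowProdEquivProdArrow α α (Fin n) (fun _ => μ)
      (fun _ => μ)).integral_comp' ]
  congr with y
  congr 2
  funext k
  simp [mix, MeasurableEquiv.arrowProdEquivProdArrow, Equiv.arrowProdEquivProdArrow]

lemma integrable_of_abs_le {β : Type*} [MeasurableSpace β] {m : Measure β} [IsFiniteMeasure m]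
    {F : β → ℝ} (hF : Measurable F) {C : ℝ} (hC : ∀ x, |F x| ≤ C) : Integrable F m :=
  Integrable.of_bound hF.aestronglyMeasurable C (ae_of_all _ hC)

lemma abs_mul_le_mul_of_abs_le {a b c d : ℝ} (h1 : |a| ≤ c) (h2 : |b| ≤ d) : |a * b| ≤ c * d := by
  rw [abs_mul]
  exact mul_le_mul h1 h2 (abs_nonneg _) ((abs_nonneg _).trans h1)

/-- Telescoping covariance formula on a product space: `F` may be corrected, in the `j`-th term,
by any function that does not depend on the `j`-th coordinate. -/
lemma covariance_eq_sum_resampling {F G : (Fin n → α) → ℝ} {F' : Fin n → (Fin n → α) → ℝ}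
    {CF CG : ℝ} (hF : Measurable F) (hG : Measurable G) (hF' : ∀ j, Measurable (F' j))
    (hCF : ∀ x, |F x| ≤ CF) (hCG : ∀ x, |G x| ≤ CG) (hCF' : ∀ j x, |F' j x| ≤ CF)
    (hind : ∀ j x x', (∀ k, k ≠ j → x k = x' k) → F' j x = F' j x') :
    (∫ x, F x * G x ∂Measure.pi fun _ => μ)
        - (∫ x, F x ∂Measure.pi fun _ => μ) * ∫ x, G x ∂Measure.pi (fun _ => μ)
      = ∑ j : Fin n, ∫ y, (F (mix 0 y) - F' j (mix 0 y)) * (G (mix j y) - G (mix (j + 1) y))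
          ∂Measure.pi fun _ => μ.prod μ := by
  have hm := fun j : ℕ => measurable_mix (n := n) (α := α) j
  have hi : ∀ {H : (Fin n → α) → ℝ}, Measurable H → (∀ x, |H x| ≤ CF) → ∀ j : ℕ,
      Integrable (fun y => H (mix 0 y) * G (mix j y)) (Measure.pi fun _ => μ.prod μ) :=
    fun hH hCH j => integrable_of_abs_le ((hH.comp (hm 0)).mul (hG.comp (hm j)))
      fun y => abs_mul_le_mul_of_abs_le (hCH _) (hCG _)
  -- Exchanging the two entries of pair j preserves the law, fixes the factor `F' j` and reverses
  -- the sign of the increment of G, so the integral equals its own negative.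
  have horth : ∀ j : Fin n,
      ∫ y, F' j (mix 0 y) * (G (mix j y) - G (mix (j + 1) y)) ∂Measure.pi (fun _ => μ.prod μ)
        = 0 := by
    intro j
    have hmeas : Measurable fun y : Fin n → α × α =>
        F' j (mix 0 y) * (G (mix j y) - G (mix (j + 1) y)) :=
      ((hF' j).comp (hm 0)).mul ((hG.comp (hm j)).sub (hG.comp (hm (j + 1))))
    have h1 := integral_map (μ := Measure.pi fun _ => μ.prod μ)
      (measurePreserving_swapAt μ j).measurable.aemeasurable hmeas.aestronglyMeasurable
    rw [(measurePreserving_swapAt μ j).map_eq] at h1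
    have h2 : ∀ y : Fin n → α × α,
        F' j (mix 0 (swapAt j y)) * (G (mix j (swapAt j y)) - G (mix (j + 1) (swapAt j y)))
          = -(F' j (mix 0 y) * (G (mix j y) - G (mix (j + 1) y))) := by
      intro y
      rw [mix_swapAt, mix_succ_swapAt,
        hind j _ _ fun k hk => mix_zero_swapAt_of_ne j y hk]
      ring
    simp_rw [h2] at h1
    rw [integral_neg] at h1
    linarith
  have h1 : ∀ j : Fin n,
      ∫ y, (F (mix 0 y) - F' j (mix 0 y)) * (G (mix j y) - G (mix (j + 1) y))
          ∂Measure.pi (fun _ => μ.prod μ)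
        = ∫ y, F (mix 0 y) * G (mix j y) ∂Measure.pi (fun _ => μ.prod μ)
          - ∫ y, F (mix 0 y) * G (mix (j + 1) y) ∂Measure.pi (fun _ => μ.prod μ) := by
    intro j
    have hiF : Integrable (fun y => F (mix 0 y) * G (mix j y) - F (mix 0 y) * G (mix (j + 1) y))
        (Measure.pi fun _ => μ.prod μ) := (hi hF hCF j).sub (hi hF hCF (j + 1))
    have hiF' : Integrable (fun y => F' j (mix 0 y) * (G (mix j y) - G (mix (j + 1) y)))
        (Measure.pi fun _ => μ.prod μ) := by
      simp only [mul_sub]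
      exact (hi (hF' j) (hCF' j) j).sub (hi (hF' j) (hCF' j) (j + 1))
    rw [← integral_sub (hi hF hCF j) (hi hF hCF (j + 1)), ← sub_zero (∫ y, (_ - _) ∂_),
      ← horth j, ← integral_sub hiF hiF']
    congr with y
    ring
  rw [Finset.sum_congr rfl fun j _ => h1 j,
    Fin.sum_univ_eq_sum_range (fun j => (∫ y, F (mix 0 y) * G (mix j y)
      ∂Measure.pi (fun _ : Fin n => μ.prod μ)) - ∫ y, F (mix 0 y) * G (mix (j + 1) y)
      ∂Measure.pi (fun _ : Fin n => μ.prod μ)) n, Finset.sum_range_sub',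
    integral_mix_zero_mul_mix, integral_comp_mix μ 0 (F := fun x => F x * G x) (hF.mul hG)]

/-- The Efron–Stein bound for functions with bounded differences. -/
lemma integral_abs_sub_integral_le_of_bounded_differences {F : (Fin n → α) → ℝ} {c C : ℝ}
    (hF : Measurable F) (hC : ∀ x, |F x| ≤ C) (hc0 : 0 ≤ c)
    (hc : ∀ x j a, |F x - F (Function.update x j a)| ≤ c) :
    ∫ x, |F x - ∫ x', F x' ∂Measure.pi fun _ => μ| ∂Measure.pi (fun _ => μ) ≤ √n * c := by
  obtain ⟨a⟩ : Nonempty α := nonempty_of_isProbabilityMeasure μ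
  have hup : ∀ j : Fin n, Measurable fun x : Fin n → α => Function.update x j a := fun j => by
    refine measurable_pi_iff.2 fun k => ?_
    by_cases hk : k = j
    · subst hk; simp
    · simpa [hk] using measurable_pi_apply k
  -- Freezing coordinate j at a fixed point a gives an admissible correction; both factors of each
  -- term are then bounded by c, so the variance is at most n c².
  have hcov := covariance_eq_sum_resampling μ (F := F) (G := F)
    (F' := fun j x => F (Function.update x j a)) hF hF (fun j => hF.comp (hup j)) hC hC
    (fun j x => hC _) fun j x x' h => by
      congr 1
      funext k
      by_cases hk : k = j
      · subst hk; simp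
      · simpa [hk] using h k hk
  set m := ∫ x, F x ∂Measure.pi fun _ => μ with hm
  have hvar : (∫ x, F x * F x ∂Measure.pi fun _ => μ) - m * m ≤ n * c ^ 2 := by
    rw [hcov]
    calc _ ≤ ∑ j : Fin n, c * c := Finset.sum_le_sum fun j _ => ?_
      _ = n * c ^ 2 := by
        rw [Finset.sum_const, Finset.card_univ, Fintype.card_fin, nsmul_eq_mul]
        ring
    refine (le_abs_self _).trans ?_
    rw [← Real.norm_eq_abs]
    refine (norm_integral_le_of_norm_le_const (C := c * c) (ae_of_all _ fun y => ?_)).trans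
      (by simp)
    refine abs_mul_le_mul_of_abs_le (hc _ _ _) ?_
    rw [mix_succ_eq_update]
    exact hc _ _ _
  have hint : Integrable F (Measure.pi fun _ => μ) := integrable_of_abs_le hF hC
  have hint2 : Integrable (fun x => F x * F x) (Measure.pi fun _ => μ) :=
    integrable_of_abs_le (hF.mul hF) fun x => abs_mul_le_mul_of_abs_le (hC x) (hC x)
  have habs : Integrable (fun x => |F x - m|) (Measure.pi fun _ => μ) :=
    (hint.sub (integrable_const m)).abs
  set s := ∫ x, |F x - m| ∂Measure.pi fun _ => μ with hs
  have hs0 : 0 ≤ s := integral_nonneg fun x => abs_nonneg _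
  -- Expanding E(|F - m| - s)² ≥ 0 gives s² ≤ Var F, the passage from variance to mean absolute
  -- deviation.
  have hnn : 0 ≤ ∫ x, (F x * F x - 2 * m * F x + (m * m + s * s) - 2 * s * |F x - m|)
      ∂Measure.pi fun _ => μ := by
    refine integral_nonneg fun x => ?_
    have := sq_nonneg (|F x - m| - s)
    have h2 := sq_abs (F x - m)
    simp only [Pi.zero_apply]
    nlinarith
  have i1 : Integrable (fun x => F x * F x - 2 * m * F x) (Measure.pi fun _ => μ) :=
    hint2.sub (hint.const_mul _)
  have i2 : Integrable (fun x => F x * F x - 2 * m * F x + (m * m + s * s))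
    (Measure.pi fun _ => μ) := i1.add (integrable_const _)
  rw [integral_sub i2 (habs.const_mul _), integral_add i1 (integrable_const _),
    integral_sub hint2 (hint.const_mul _), integral_const_mul, integral_const_mul, ← hm, ← hs]
    at hnn
  simp only [integral_const, probReal_univ, one_smul] at hnn
  have hle : s ^ 2 ≤ n * c ^ 2 := by nlinarith
  calc s ≤ √(n * c ^ 2) := Real.le_sqrt_of_sq_le hle
    _ = √n * c := by rw [Real.sqrt_mul (by positivity), Real.sqrt_sq hc0]

end Resampling

lemma abs_sub_le_of_mem {a b M : ℝ} (ha : 0 ≤ a) (hb : 0 ≤ b) (haM : a ≤ M) (hbM : b ≤ M) :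
    |a - b| ≤ M := abs_le.2 ⟨by linarith, by linarith⟩

/-! ### Disjoint regions and integration over one coordinate -/

section ConditionalBounds

variable {β : Type*} [MeasurableSpace β]

lemma sum_measureReal_inter_le {ι : Type*} {J : Finset ι} {l : Measure β} {E : ι → Set β} {A : Set β}
    (hE : ∀ j ∈ J, MeasurableSet (E j)) (hA : MeasurableSet A) (hAfin : l A ≠ ⊤)
    (hd : (J : Set ι).PairwiseDisjoint E) : ∑ j ∈ J, l.real (E j ∩ A) ≤ l.real A := by
  rw [← measureReal_biUnion_finset (hd.mono fun j => Set.inter_subset_left)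
    (fun j hj => (hE j hj).inter hA)
    (fun j _ => measure_ne_top_of_subset Set.inter_subset_right hAfin)]
  exact measureReal_mono (Set.iUnion₂_subset fun j _ => Set.inter_subset_right) hAfin

/-- Fubini: integrate over coordinate j first, with the others frozen. -/
lemma integral_pi_le_of_forall_update {n : ℕ} (κ : Measure β) [IsProbabilityMeasure κ]
    {H : (Fin n → β) → ℝ} {C K : ℝ} (hH : Measurable H) (hC : ∀ y, |H y| ≤ C) (j : Fin n)
    (hK : ∀ y, ∫ p, H (Function.update y j p) ∂κ ≤ K) :
    ∫ y, H y ∂Measure.pi (fun _ => κ) ≤ K := by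
  obtain ⟨p₀⟩ : Nonempty β := nonempty_of_isProbabilityMeasure κ
  obtain _ | n := n
  · exact j.elim0
  have e := (measurePreserving_piFinSuccAbove (fun _ : Fin (n + 1) => κ) j).symm
  have hm : Measurable fun q : β × (Fin n → β) =>
      H ((MeasurableEquiv.piFinSuccAbove (fun _ => β) j).symm q) :=
    hH.comp (MeasurableEquiv.measurable _)
  rw [← e.integral_comp', integral_prod_symm _ (integrable_of_abs_le hm fun q => hC _)]
  have hle : ∀ r : Fin n → β,
      ∫ p, H ((MeasurableEquiv.piFinSuccAbove (fun _ => β) j).symm (p, r)) ∂κ ≤ K := by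
    intro r
    convert hK ((MeasurableEquiv.piFinSuccAbove (fun _ => β) j).symm (p₀, r)) using 4 with p
    simp [MeasurableEquiv.piFinSuccAbove, Fin.insertNthEquiv]
  have hint := (integrable_of_abs_le (m := κ.prod (Measure.pi fun _ : Fin n => κ)) hm
    fun q => hC _).integral_prod_right
  refine (integral_mono hint (integrable_const K) hle).trans ?_
  simp

/-- The mean difference of two independent copies of a variable with values in `[0, M]` is at most
`M / 2`. -/
lemma integral_abs_sub_le_half (μ : Measure β) [IsProbabilityMeasure μ] {g : β → ℝ} {M : ℝ}
    (hg : Measurable g) (h0 : ∀ a, 0 ≤ g a) (hM : ∀ a, g a ≤ M) :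
    ∫ p, |g p.1 - g p.2| ∂μ.prod μ ≤ M / 2 := by
  obtain ⟨a⟩ : Nonempty β := nonempty_of_isProbabilityMeasure μ
  have hM0 : 0 ≤ M := (h0 a).trans (hM a)
  have habs : ∀ a, |g a| ≤ M := fun a => by rw [abs_of_nonneg (h0 a)]; exact hM a
  have hi1 : Integrable (fun p : β × β => g p.1) (μ.prod μ) :=
    integrable_of_abs_le (hg.comp measurable_fst) fun p => habs _
  have hi2 : Integrable (fun p : β × β => g p.2) (μ.prod μ) :=
    integrable_of_abs_le (hg.comp measurable_snd) fun p => habs _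
  have hi3 : Integrable (fun p : β × β => g p.1 * g p.2) (μ.prod μ) :=
    integrable_of_abs_le ((hg.comp measurable_fst).mul (hg.comp measurable_snd))
      fun p => abs_mul_le_mul_of_abs_le (habs _) (habs _)
  have hi12 : Integrable (fun p : β × β => M * g p.1 + M * g p.2) (μ.prod μ) :=
    (hi1.const_mul M).add (hi2.const_mul M)
  -- On [0, M] one has M|a - b| ≤ Ma + Mb - 2ab. By independence the right side integrates to 2Mγ -
  -- 2γ² ≤ M²/2, with γ the mean of g. The saved factor 2 produces the 1/2 in the final M³ term.
  have key : M * ∫ p, |g p.1 - g p.2| ∂μ.prod μ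
      ≤ ∫ p, (M * g p.1 + M * g p.2 - 2 * (g p.1 * g p.2)) ∂μ.prod μ := by
    rw [← integral_const_mul]
    refine integral_mono ((hi1.sub hi2).abs.const_mul M) (hi12.sub (hi3.const_mul 2)) fun p => ?_
    have h1 := mul_nonneg (h0 p.1) (sub_nonneg.2 (hM p.2))
    have h2 := mul_nonneg (h0 p.2) (sub_nonneg.2 (hM p.1))
    simp only
    rcases abs_cases (g p.1 - g p.2) with ⟨h, _⟩ | ⟨h, _⟩ <;> rw [h] <;> nlinarith
  rw [integral_sub hi12 (hi3.const_mul 2), integral_add (hi1.const_mul M) (hi2.const_mul M),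
    integral_const_mul, integral_const_mul, integral_const_mul, integral_prod_mul,
    integral_fun_fst (f := g), integral_fun_snd (f := g)] at key
  simp only [probReal_univ, one_smul] at key
  rcases hM0.eq_or_lt with rfl | hpos
  · have : ∀ a, g a = 0 := fun a => le_antisymm (hM a) (h0 a)
    simp [this]
  · refine le_of_mul_le_mul_left (key.trans ?_) hpos
    nlinarith [sq_nonneg (M - 2 * ∫ a, g a ∂μ)]

end ConditionalBounds

/-! ### Exposed volumes and the variance statistic -/

section Coverage

variable {𝒳 : Type*} [MetricSpace 𝒳] [MeasurableSpace 𝒳] {n : ℕ}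

/-- The volume covered by the balls with indices in `s`. -/
noncomputable def volumeOn (l : Measure 𝒳) (ε : ℝ) (s : Set (Fin n)) (x : Fin n → 𝒳) : ℝ :=
  l.real (⋃ k ∈ s, Metric.closedBall (x k) ε)

/-- The volume covered by the ball with index `j` and no other. -/
noncomputable def exposed (l : Measure 𝒳) (ε : ℝ) (j : Fin n) (x : Fin n → 𝒳) : ℝ :=
  l.real (Metric.closedBall (x j) ε \ ⋃ k ∈ ({j}ᶜ : Set (Fin n)), Metric.closedBall (x k) ε)

variable {l : Measure 𝒳} {ε : ℝ}

lemma volumeOn_congr {s : Set (Fin n)} {x x' : Fin n → 𝒳} (h : ∀ k ∈ s, x k = x' k) :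
    volumeOn l ε s x = volumeOn l ε s x' := by
  unfold volumeOn
  congr 1
  exact Set.iUnion₂_congr fun k hk => by rw [h k hk]

lemma exposed_nonneg (j : Fin n) (x : Fin n → 𝒳) : 0 ≤ exposed l ε j x := measureReal_nonneg

lemma measure_closedBall_ne_top (hM : maxBall l ε ≠ ⊤) (u : 𝒳) :
    l (Metric.closedBall u ε) ≠ ⊤ :=
  ne_top_of_le_ne_top hM (le_iSup (fun u => l (Metric.closedBall u ε)) u)

lemma measureReal_closedBall_le (hM : maxBall l ε ≠ ⊤) (u : 𝒳) :
    l.real (Metric.closedBall u ε) ≤ (maxBall l ε).toReal :=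
  ENNReal.toReal_mono hM (le_iSup (fun u => l (Metric.closedBall u ε)) u)

lemma exposed_le (hM : maxBall l ε ≠ ⊤) (j : Fin n) (x : Fin n → 𝒳) :
    exposed l ε j x ≤ (maxBall l ε).toReal :=
  (measureReal_mono Set.sdiff_subset (measure_closedBall_ne_top hM _)).trans
    (measureReal_closedBall_le hM _)

lemma measure_biUnion_closedBall_ne_top (hM : maxBall l ε ≠ ⊤) (s : Set (Fin n))
    (x : Fin n → 𝒳) : l (⋃ k ∈ s, Metric.closedBall (x k) ε) ≠ ⊤ :=
  (measure_biUnion_lt_top s.toFinite fun k _ => (measure_closedBall_ne_top hM (x k)).lt_top).ne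

lemma volumeOn_le_univ (hM : maxBall l ε ≠ ⊤) (s : Set (Fin n)) (x : Fin n → 𝒳) :
    volumeOn l ε s x ≤ volumeOn l ε Set.univ x :=
  measureReal_mono (Set.biUnion_subset_biUnion_left (Set.subset_univ s))
    (measure_biUnion_closedBall_ne_top hM _ _)

lemma volumeOn_univ_le (hM : maxBall l ε ≠ ⊤) (x : Fin n → 𝒳) :
    volumeOn l ε Set.univ x ≤ n * (maxBall l ε).toReal := by
  unfold volumeOn
  simp only [Set.mem_univ, Set.iUnion_true]
  calc _ ≤ ∑ k, l.real (Metric.closedBall (x k) ε) := measureReal_iUnion_fintype_le _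
    _ ≤ ∑ _k : Fin n, (maxBall l ε).toReal :=
        Finset.sum_le_sum fun k _ => measureReal_closedBall_le hM _
    _ = _ := by simp

lemma abs_volumeOn_le (hM : maxBall l ε ≠ ⊤) (s : Set (Fin n)) (x : Fin n → 𝒳) :
    |volumeOn l ε s x| ≤ n * (maxBall l ε).toReal := by
  rw [volumeOn, abs_of_nonneg measureReal_nonneg]
  exact (volumeOn_le_univ hM s x).trans (volumeOn_univ_le hM x)

lemma abs_exposed_sub_le (hM : maxBall l ε ≠ ⊤) (j : Fin n) (x x' : Fin n → 𝒳) :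
    |exposed l ε j x - exposed l ε j x'| ≤ (maxBall l ε).toReal :=
  abs_sub_le_of_mem (exposed_nonneg _ _) (exposed_nonneg _ _) (exposed_le hM _ _)
    (exposed_le hM _ _)

lemma abs_exposed_le (hM : maxBall l ε ≠ ⊤) (j : Fin n) (x : Fin n → 𝒳) :
    |exposed l ε j x| ≤ (maxBall l ε).toReal := by
  rw [abs_of_nonneg (exposed_nonneg _ _)]
  exact exposed_le hM _ _

/-- Closed ε-balls are neighbourhoods of finite measure, so l is locally finite on a second
countable space. This makes covered volumes measurable in the centres. -/
lemma sigmaFinite_of_maxBall_ne_top [TopologicalSpace.SeparableSpace 𝒳] (hε : 0 < ε)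
    (hM : maxBall l ε ≠ ⊤) : SigmaFinite l := by
  have : SecondCountableTopology 𝒳 := UniformSpace.secondCountable_of_separable 𝒳
  have : IsLocallyFiniteMeasure l := ⟨fun x => ⟨Metric.closedBall x ε,
    Metric.closedBall_mem_nhds x hε, (measure_closedBall_ne_top hM x).lt_top⟩⟩
  infer_instance

/-- The approximate variance statistic. -/
noncomputable def varStat (l : Measure 𝒳) (ε : ℝ) (y : Fin n → 𝒳 × 𝒳) : ℝ :=
  ∑ j : Fin n, exposed l ε j (mix 0 y) * (exposed l ε j (mix j y) - exposed l ε j (mix (j + 1) y))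

lemma abs_varStat_le (hM : maxBall l ε ≠ ⊤) (y : Fin n → 𝒳 × 𝒳) :
    |varStat l ε y| ≤ n * (maxBall l ε).toReal ^ 2 := by
  unfold varStat
  refine (Finset.abs_sum_le_sum_abs _ _).trans ?_
  refine (Finset.sum_le_sum fun j _ => abs_mul_le_mul_of_abs_le (abs_exposed_le hM j _)
    (abs_exposed_sub_le hM j _ _)).trans_eq ?_
  rw [Finset.sum_const, Finset.card_univ, Fintype.card_fin, nsmul_eq_mul]
  ring

lemma coveredVolume_eq_volumeOn {Ω : Type*} (X : Fin n → Ω → 𝒳) (ω : Ω) :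
    coveredVolume l ε X ω = volumeOn l ε Set.univ fun i => X i ω := by
  simp [coveredVolume, coveredRegion, volumeOn, Measure.real]

lemma variance_coveredVolume_zero {Ω : Type*} [MeasurableSpace Ω] (P : Measure Ω)
    [IsProbabilityMeasure P] (X : Fin 0 → Ω → 𝒳) : Var[coveredVolume l ε X; P] = 0 := by
  have : coveredVolume l ε X = 0 := by
    funext ω
    simp [coveredVolume, coveredRegion]
  rw [this, variance_zero]

variable [BorelSpace 𝒳]

lemma volumeOn_univ_eq_add (hM : maxBall l ε ≠ ⊤) (j : Fin n) (x : Fin n → 𝒳) :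
    volumeOn l ε Set.univ x = exposed l ε j x + volumeOn l ε {j}ᶜ x := by
  unfold volumeOn exposed
  have hmeas : MeasurableSet (⋃ k ∈ ({j}ᶜ : Set (Fin n)), Metric.closedBall (x k) ε) :=
    .biUnion (Set.to_countable _) fun k _ => measurableSet_closedBall
  rw [← measureReal_union Set.disjoint_sdiff_left hmeas
    (measure_ne_top_of_subset Set.sdiff_subset (measure_closedBall_ne_top hM _))
    (measure_biUnion_closedBall_ne_top hM _ _), Set.sdiff_union_self,
    ← Set.biUnion_insert j {j}ᶜ fun k => Metric.closedBall (x k) ε, ← Set.singleton_union,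
    Set.union_compl_self]

/-- Isolates the role of centre i: it enters only through the intersection of ball i with a region
that does not involve i. -/
lemma exposed_eq_sub (hM : maxBall l ε ≠ ⊤) {i j : Fin n} (hij : i ≠ j) (x : Fin n → 𝒳) :
    exposed l ε j x
      = l.real (Metric.closedBall (x j) ε \
          ⋃ k ∈ ({i, j}ᶜ : Set (Fin n)), Metric.closedBall (x k) ε)
        - l.real ((Metric.closedBall (x j) ε \
          ⋃ k ∈ ({i, j}ᶜ : Set (Fin n)), Metric.closedBall (x k) ε) ∩
            Metric.closedBall (x i) ε) := by
  have h := measureReal_inter_add_sdiff (μ := l) (s := Metric.closedBall (x j) ε \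
      ⋃ k ∈ ({i, j}ᶜ : Set (Fin n)), Metric.closedBall (x k) ε)
    (t := Metric.closedBall (x i) ε) measurableSet_closedBall
    (measure_ne_top_of_subset Set.sdiff_subset (measure_closedBall_ne_top hM _))
  rw [← h, exposed, Set.sdiff_sdiff]
  have : (⋃ k ∈ ({j}ᶜ : Set (Fin n)), Metric.closedBall (x k) ε)
      = (⋃ k ∈ ({i, j}ᶜ : Set (Fin n)), Metric.closedBall (x k) ε) ∪
        Metric.closedBall (x i) ε := by
    have hs : ({j}ᶜ : Set (Fin n)) = insert i ({i, j}ᶜ) := by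
      ext k
      simp only [Set.mem_compl_iff, Set.mem_singleton_iff, Set.mem_insert_iff]
      by_cases hk : k = i
      · simp [hk, hij]
      · simp [hk]
    rw [hs, Set.biUnion_insert, Set.union_comm]
  rw [this]
  ring

/-- The total effect of moving one centre on the exposed volumes of the others is bounded,
because the relevant regions are disjoint. -/
lemma sum_abs_exposed_sub_le (hM : maxBall l ε ≠ ⊤) {u u' : Fin n → Fin n → 𝒳} (i : Fin n)
    {A : Set 𝒳} (hA : MeasurableSet A) (hAfin : l A ≠ ⊤)
    (hagree : ∀ j k, k ≠ i → u' j k = u j k)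
    (hdisj : ∀ j j', j < j' → u j j' = u j' j' ∨ u j' j = u j j)
    (hu : ∀ j, Metric.closedBall (u j i) ε ⊆ A) (hu' : ∀ j, Metric.closedBall (u' j i) ε ⊆ A) :
    ∑ j ∈ Finset.univ.erase i, |exposed l ε j (u j) - exposed l ε j (u' j)| ≤ l.real A := by
  set E : Fin n → Set 𝒳 := fun j => Metric.closedBall (u j j) ε \
    ⋃ k ∈ ({i, j}ᶜ : Set (Fin n)), Metric.closedBall (u j k) ε with hE
  -- `E j` removes the ball around `u j j'`, whereas `E j'` lies inside the ball around `u j' j'`;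
  -- agreement of these two centres forces disjointness. Since the configuration varies with j, the
  -- agreement may hold in only one of the two orders.
  have hsep : ∀ j j', j ≠ i → j' ≠ i → j ≠ j' → u j j' = u j' j' → Disjoint (E j) (E j') := by
    intro j j' _ hj' hne heq
    refine Set.disjoint_left.2 fun p hp hp' => hp.2 ?_
    refine Set.mem_biUnion (x := j') (by simp [hj', hne.symm]) ?_
    rw [heq]
    exact hp'.1
  refine le_trans (Finset.sum_le_sum fun j hj => ?_) (sum_measureReal_inter_le (l := l) (E := E)
    (J := Finset.univ.erase i) (fun j _ => ?_) hA hAfin ?_)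
  · have hji : i ≠ j := (Finset.ne_of_mem_erase hj).symm
    have hE' : (Metric.closedBall (u' j j) ε \
        ⋃ k ∈ ({i, j}ᶜ : Set (Fin n)), Metric.closedBall (u' j k) ε) = E j := by
      rw [hE, hagree j j hji.symm]
      congr 1
      refine Set.iUnion₂_congr fun k hk => ?_
      rw [hagree j k fun h => hk (by simp [h])]
    have hfin : l (E j ∩ A) ≠ ⊤ := measure_ne_top_of_subset Set.inter_subset_right hAfin
    rw [exposed_eq_sub hM hji, exposed_eq_sub hM hji, hE']
    -- The difference of exposed volumes is a difference of two numbers in [0, l(E j ∩ A)].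
    have h1 := measureReal_mono (μ := l) (Set.inter_subset_inter_right (E j) (hu j)) hfin
    have h2 := measureReal_mono (μ := l) (Set.inter_subset_inter_right (E j) (hu' j)) hfin
    have h3 : 0 ≤ l.real (E j ∩ Metric.closedBall (u j i) ε) := measureReal_nonneg
    have h4 : 0 ≤ l.real (E j ∩ Metric.closedBall (u' j i) ε) := measureReal_nonneg
    simp only [hE] at h1 h2 h3 h4 ⊢
    rw [abs_le]
    constructor <;> linarith
  · exact measurableSet_closedBall.diff
      (.biUnion (Set.to_countable _) fun k _ => measurableSet_closedBall)
  · intro j hj j' hj' hne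
    have hj := Finset.ne_of_mem_erase hj
    have hj' := Finset.ne_of_mem_erase hj'
    have h : u j j' = u j' j' ∨ u j' j = u j j := by
      rcases lt_or_gt_of_ne hne with h | h
      · exact hdisj j j' h
      · exact (hdisj j' j h).symm
    rcases h with h | h
    · exact hsep j j' hj hj' hne h
    · exact (hsep j' j hj' hj hne.symm h).symm

lemma mix_update_of_ne {α : Type*} (m : ℕ) (y : Fin n → α × α) {i k : Fin n} (z : α × α)
    (hk : k ≠ i) : mix m (Function.update y i z) k = mix m y k := by
  simp [mix, Function.update_of_ne hk]

lemma mix_apply_eq_or {α : Type*} (m : ℕ) (y : Fin n → α × α) (k : Fin n) :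
    mix m y k = (y k).1 ∨ mix m y k = (y k).2 := by
  unfold mix
  split_ifs <;> simp

/-- All balls that can sit at index i, before or after the change, lie in a union of four. For j <
j', the first two choices of m use the first entry at j' in both configurations, and the third uses
the second entry at j in both; this supplies the disjointness. -/
lemma sum_abs_exposed_mix_sub_le (hM : maxBall l ε ≠ ⊤) (m : Fin n → ℕ)
    (hm : (∀ j, m j = 0) ∨ (∀ j, m j = j) ∨ ∀ j, m j = j + 1) (y : Fin n → 𝒳 × 𝒳) (i : Fin n)
    (z : 𝒳 × 𝒳) :
    ∑ j ∈ Finset.univ.erase i,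
      |exposed l ε j (mix (m j) y) - exposed l ε j (mix (m j) (Function.update y i z))|
        ≤ 4 * (maxBall l ε).toReal := by
  set A : Set 𝒳 := (Metric.closedBall (y i).1 ε ∪ Metric.closedBall (y i).2 ε) ∪
    (Metric.closedBall z.1 ε ∪ Metric.closedBall z.2 ε) with hA
  have hfin := fun u : 𝒳 => measure_closedBall_ne_top hM u
  have hAfin : l A ≠ ⊤ := measure_union_ne_top (measure_union_ne_top (hfin _) (hfin _))
    (measure_union_ne_top (hfin _) (hfin _))
  have hle : l.real A ≤ 4 * (maxBall l ε).toReal := by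
    have h1 := measureReal_union_le (μ := l) (Metric.closedBall (y i).1 ε ∪
      Metric.closedBall (y i).2 ε) (Metric.closedBall z.1 ε ∪ Metric.closedBall z.2 ε)
    have h2 := measureReal_union_le (μ := l) (Metric.closedBall (y i).1 ε)
      (Metric.closedBall (y i).2 ε)
    have h3 := measureReal_union_le (μ := l) (Metric.closedBall z.1 ε) (Metric.closedBall z.2 ε)
    have h4 := fun u : 𝒳 => measureReal_closedBall_le hM u
    linarith [h4 (y i).1, h4 (y i).2, h4 z.1, h4 z.2]
  refine (sum_abs_exposed_sub_le hM (u := fun j => mix (m j) y)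
    (u' := fun j => mix (m j) (Function.update y i z)) i (A := A)
    ((measurableSet_closedBall.union measurableSet_closedBall).union
      (measurableSet_closedBall.union measurableSet_closedBall)) hAfin
    (fun j k hk => mix_update_of_ne _ _ _ hk) (fun j j' hjj' => ?_) (fun j => ?_)
    fun j => ?_).trans hle
  · have h : (j : ℕ) < j' := hjj'
    rcases hm with hm | hm | hm
    · left
      simp [hm]
    · left
      simp [mix, hm, hjj'.not_gt]
    · right
      simp [mix, hm, Nat.lt_succ_of_lt h]
  · rcases mix_apply_eq_or (m j) y i with h | h <;> simp only [h, hA]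
    · exact fun p hp => Or.inl (Or.inl hp)
    · exact fun p hp => Or.inl (Or.inr hp)
  · rcases mix_apply_eq_or (m j) (Function.update y i z) i with h | h <;>
      simp only [h, hA, Function.update_self]
    · exact fun p hp => Or.inr (Or.inl hp)
    · exact fun p hp => Or.inr (Or.inr hp)

/-- The i-th term changes by at most 2M². In the other terms, the product rule leaves three sums of
exposed-volume changes, each at most 4M and multiplied by M: 14 = 2 + 3·4. -/
lemma abs_varStat_sub_update_le (hM : maxBall l ε ≠ ⊤) (y : Fin n → 𝒳 × 𝒳) (i : Fin n)
    (z : 𝒳 × 𝒳) :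
    |varStat l ε y - varStat l ε (Function.update y i z)| ≤ 14 * (maxBall l ε).toReal ^ 2 := by
  set M := (maxBall l ε).toReal with hMdef
  have hM0 : 0 ≤ M := ENNReal.toReal_nonneg
  set y' := Function.update y i z with hy'
  unfold varStat
  rw [← Finset.sum_sub_distrib]
  refine (Finset.abs_sum_le_sum_abs _ _).trans ?_
  rw [← Finset.add_sum_erase _ _ (Finset.mem_univ i)]
  have hterm : ∀ (j : Fin n) (y : Fin n → 𝒳 × 𝒳), |exposed l ε j (mix 0 y) *
      (exposed l ε j (mix j y) - exposed l ε j (mix (j + 1) y))| ≤ M * M := fun j y =>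
    abs_mul_le_mul_of_abs_le (abs_exposed_le hM _ _) (abs_exposed_sub_le hM _ _ _)
  have hi := (abs_sub _ _).trans (add_le_add (hterm i y) (hterm i y'))
  have hs0 := sum_abs_exposed_mix_sub_le hM (fun _ => 0) (Or.inl fun _ => rfl) y i z
  have hs1 := sum_abs_exposed_mix_sub_le hM (fun j => j) (Or.inr (Or.inl fun _ => rfl)) y i z
  have hs2 := sum_abs_exposed_mix_sub_le hM (fun j => j + 1) (Or.inr (Or.inr fun _ => rfl)) y i z
  rw [← hMdef, ← hy'] at hs0 hs1 hs2
  have hrest : ∑ j ∈ Finset.univ.erase i, |exposed l ε j (mix 0 y) *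
        (exposed l ε j (mix j y) - exposed l ε j (mix (j + 1) y))
      - exposed l ε j (mix 0 y') * (exposed l ε j (mix j y') - exposed l ε j (mix (j + 1) y'))|
      ≤ ∑ j ∈ Finset.univ.erase i, (M * |exposed l ε j (mix 0 y) - exposed l ε j (mix 0 y')|
        + M * |exposed l ε j (mix j y) - exposed l ε j (mix j y')|
        + M * |exposed l ε j (mix (j + 1) y) - exposed l ε j (mix (j + 1) y')|) := by
    refine Finset.sum_le_sum fun j _ => ?_
    have h1 := abs_mul_le_mul_of_abs_le
      (le_refl |exposed l ε j (mix 0 y) - exposed l ε j (mix 0 y')|)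
      (abs_exposed_sub_le hM j (mix j y) (mix (j + 1) y))
    have h2 := abs_mul_le_mul_of_abs_le (abs_exposed_le hM j (mix 0 y'))
      (le_refl |exposed l ε j (mix j y) - exposed l ε j (mix j y')|)
    have h3 := abs_mul_le_mul_of_abs_le (abs_exposed_le hM j (mix 0 y'))
      (le_refl |exposed l ε j (mix (j + 1) y) - exposed l ε j (mix (j + 1) y')|)
    rw [← hMdef] at h1 h2 h3
    rw [abs_le] at h1 h2 h3 ⊢
    constructor <;> linarith
  rw [Finset.sum_add_distrib, Finset.sum_add_distrib, ← Finset.mul_sum, ← Finset.mul_sum,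
    ← Finset.mul_sum] at hrest
  nlinarith [mul_le_mul_of_nonneg_left hs0 hM0, mul_le_mul_of_nonneg_left hs1 hM0,
    mul_le_mul_of_nonneg_left hs2 hM0]

lemma measurable_volumeOn [TopologicalSpace.SeparableSpace 𝒳] [SFinite l] (s : Set (Fin n)) :
    Measurable fun x : Fin n → 𝒳 => volumeOn l ε s x := by
  have : SecondCountableTopology 𝒳 := UniformSpace.secondCountable_of_separable 𝒳
  have hset : MeasurableSet {q : (Fin n → 𝒳) × 𝒳 |
      q.2 ∈ ⋃ k ∈ s, Metric.closedBall (q.1 k) ε} := by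
    have : {q : (Fin n → 𝒳) × 𝒳 | q.2 ∈ ⋃ k ∈ s, Metric.closedBall (q.1 k) ε}
        = ⋃ k ∈ s, {q : (Fin n → 𝒳) × 𝒳 | dist q.2 (q.1 k) ≤ ε} := by
      ext q
      simp
    rw [this]
    refine .biUnion (Set.to_countable _) fun k _ => ?_
    exact measurableSet_le (by fun_prop) measurable_const
  exact (measurable_measure_prodMk_left hset).ennreal_toReal

lemma measurable_exposed [TopologicalSpace.SeparableSpace 𝒳] [SFinite l]
    (hM : maxBall l ε ≠ ⊤) (j : Fin n) :
    Measurable fun x : Fin n → 𝒳 => exposed l ε j x := by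
  have h : (fun x : Fin n → 𝒳 => exposed l ε j x)
      = fun x => volumeOn l ε Set.univ x - volumeOn l ε {j}ᶜ x := by
    funext x
    rw [volumeOn_univ_eq_add hM j x]
    ring
  rw [h]
  exact (measurable_volumeOn _).sub (measurable_volumeOn _)

lemma measurable_varStat [TopologicalSpace.SeparableSpace 𝒳] [SFinite l]
    (hM : maxBall l ε ≠ ⊤) : Measurable fun y : Fin n → 𝒳 × 𝒳 => varStat l ε y := by
  unfold varStat
  refine Finset.measurable_sum _ fun j _ => ?_
  have h := measurable_exposed (ε := ε) (l := l) hM j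
  exact (h.comp (measurable_mix 0)).mul ((h.comp (measurable_mix _)).sub (h.comp (measurable_mix _)))

/-- The two configurations differ only at j, where they carry independent copies; with the rest
frozen, the half-range bound `integral_abs_sub_le_half` applies. -/
lemma integral_abs_exposed_mix_sub_le [TopologicalSpace.SeparableSpace 𝒳] [SFinite l]
    (hM : maxBall l ε ≠ ⊤) (ν : Measure 𝒳) [IsProbabilityMeasure ν] (j : Fin n) :
    ∫ y, |exposed l ε j (mix j y) - exposed l ε j (mix (j + 1) y)|
      ∂Measure.pi (fun _ => ν.prod ν) ≤ (maxBall l ε).toReal / 2 := by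
  have h := measurable_exposed (ε := ε) (l := l) hM j
  refine integral_pi_le_of_forall_update (ν.prod ν)
    (((h.comp (measurable_mix _)).sub (h.comp (measurable_mix _))).abs)
    (fun y => by rw [abs_abs]; exact abs_exposed_sub_le hM j _ _) j fun y => ?_
  have h1 : ∀ p : 𝒳 × 𝒳, mix j (Function.update y j p) = Function.update (mix j y) j p.1 := by
    intro p
    funext k
    by_cases hk : k = j
    · subst hk; simp [mix]
    · rw [mix_update_of_ne _ _ _ hk, Function.update_of_ne hk]
  have h2 : ∀ p : 𝒳 × 𝒳, mix (j + 1) (Function.update y j p)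
      = Function.update (mix j y) j p.2 := by
    intro p
    rw [mix_succ_eq_update, h1]
    simp
  simp only [h1, h2]
  exact integral_abs_sub_le_half ν (g := fun a => exposed l ε j (Function.update (mix j y) j a))
    (h.comp (measurable_update (mix j y))) (fun a => exposed_nonneg _ _)
    fun a => exposed_le hM _ _

lemma volumeOn_univ_sub_mix (hM : maxBall l ε ≠ ⊤) (j : Fin n) (y : Fin n → 𝒳 × 𝒳) :
    volumeOn l ε Set.univ (mix j y) - volumeOn l ε Set.univ (mix (j + 1) y)
      = exposed l ε j (mix j y) - exposed l ε j (mix (j + 1) y) := by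
  rw [volumeOn_univ_eq_add hM j, volumeOn_univ_eq_add hM j,
    volumeOn_congr (x := mix j y) (x' := mix (j + 1) y) fun k hk => ?_]
  · ring
  · rw [mix_succ_eq_update, Function.update_of_ne (by simpa using hk)]

end Coverage

/-! ### Normal approximation of the covered volume -/

section NormalApproximation

variable {𝒳 : Type*} [MetricSpace 𝒳] [TopologicalSpace.SeparableSpace 𝒳] [MeasurableSpace 𝒳]
  [BorelSpace 𝒳] {n : ℕ} {l : Measure 𝒳} {ε : ℝ}

/-- Covariance of a function of the covered volume with the covered volume. -/
lemma covariance_comp_volumeOn [SFinite l] (hM : maxBall l ε ≠ ⊤) (ν : Measure 𝒳)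
    [IsProbabilityMeasure ν] {F : ℝ → ℝ} (hF : Continuous F) :
    (∫ x, F (volumeOn l ε Set.univ x) * volumeOn l ε Set.univ x
        ∂Measure.pi fun _ : Fin n => ν)
      - (∫ x, F (volumeOn l ε Set.univ x) ∂Measure.pi fun _ : Fin n => ν)
        * ∫ x, volumeOn l ε Set.univ x ∂Measure.pi (fun _ : Fin n => ν)
      = ∑ j : Fin n, ∫ y, (F (volumeOn l ε Set.univ (mix 0 y))
            - F (volumeOn l ε Set.univ (mix 0 y) - exposed l ε j (mix 0 y)))
          * (exposed l ε j (mix j y) - exposed l ε j (mix (j + 1) y))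
            ∂Measure.pi fun _ => ν.prod ν := by
  -- Covered volumes stay in a fixed compact interval, so continuity of F alone gives the
  -- boundedness required by the resampling formula.
  obtain ⟨C, hC⟩ := isCompact_Icc.exists_bound_of_continuousOn
    (s := Set.Icc (-(n * (maxBall l ε).toReal)) (n * (maxBall l ε).toReal)) hF.continuousOn
  have hCs : ∀ (s : Set (Fin n)) x, |F (volumeOn l ε s x)| ≤ C := fun s x =>
    hC _ (abs_le.1 (abs_volumeOn_le hM s x))
  have := covariance_eq_sum_resampling ν (F := fun x => F (volumeOn l ε Set.univ x))
    (G := volumeOn l ε Set.univ) (F' := fun j x => F (volumeOn l ε {j}ᶜ x))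
    (hF.measurable.comp (measurable_volumeOn _)) (measurable_volumeOn _)
    (fun j => hF.measurable.comp (measurable_volumeOn _)) (hCs _) (abs_volumeOn_le hM _)
    (fun j => hCs _) fun j x x' h => by
      rw [volumeOn_congr (x := x) (x' := x') fun k hk => h k (by simpa using hk)]
  rw [this]
  refine Finset.sum_congr rfl fun j _ => integral_congr_ae (ae_of_all _ fun y => ?_)
  simp only
  rw [volumeOn_univ_sub_mix hM, volumeOn_univ_eq_add hM j (mix 0 y), add_sub_cancel_left]

/-- Normal approximation of the covered volume, tested against a Lipschitz function. -/
lemma abs_integral_sub_gaussian_le [SFinite l] (hM : maxBall l ε ≠ ⊤) (ν : Measure 𝒳)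
    [IsProbabilityMeasure ν] {h : ℝ → ℝ} (hh : LipschitzWith 1 h) {m σ : ℝ} (hσ : 0 < σ)
    (hm : m = ∫ x, volumeOn l ε Set.univ x ∂Measure.pi fun _ : Fin n => ν)
    (hvar : σ ^ 2 = (∫ x, volumeOn l ε Set.univ x * volumeOn l ε Set.univ x
        ∂Measure.pi fun _ : Fin n => ν) - m * m) :
    |(∫ x, h ((volumeOn l ε Set.univ x - m) / σ) ∂Measure.pi fun _ : Fin n => ν)
        - ∫ t, h t ∂gaussianReal 0 1|
      ≤ 56 * √n * (maxBall l ε).toReal ^ 2 / σ ^ 2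
        + n * (maxBall l ε).toReal ^ 3 / (2 * σ ^ 3) := by
  obtain ⟨f, f', hf, hf', hstein, hbound, htaylor⟩ := exists_stein_solution hh
  set M := (maxBall l ε).toReal with hMdef
  have hM0 : 0 ≤ M := ENNReal.toReal_nonneg
  set V : (Fin n → 𝒳) → ℝ := volumeOn l ε Set.univ with hV
  have hVm : Measurable V := measurable_volumeOn _
  set w : (Fin n → 𝒳) → ℝ := fun x => (V x - m) / σ with hw
  have hwm : Measurable w := (hVm.sub_const m).div_const σ
  set Q := Measure.pi fun _ : Fin n => ν.prod ν with hQ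
  set T : (Fin n → 𝒳 × 𝒳) → ℝ := varStat l ε with hT
  have hTm : Measurable T := measurable_varStat hM
  have hTi : Integrable T Q := integrable_of_abs_le hTm (abs_varStat_le hM)
  have hE := fun j : Fin n => measurable_exposed (ε := ε) (l := l) hM j
  set d : Fin n → (Fin n → 𝒳 × 𝒳) → ℝ := fun j y => exposed l ε j (mix 0 y) with hd
  set D : Fin n → (Fin n → 𝒳 × 𝒳) → ℝ := fun j y =>
    exposed l ε j (mix j y) - exposed l ε j (mix (j + 1) y) with hD
  have hdm : ∀ j, Measurable (d j) := fun j => (hE j).comp (measurable_mix 0)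
  have hDm : ∀ j, Measurable (D j) := fun j =>
    ((hE j).comp (measurable_mix _)).sub ((hE j).comp (measurable_mix _))
  have hdb : ∀ j y, |d j y| ≤ M := fun j y => abs_exposed_le hM _ _
  have hDb : ∀ j y, |D j y| ≤ M := fun j y => abs_exposed_sub_le hM _ _ _
  have hdDi : ∀ j, Integrable (fun y => d j y * D j y) Q := fun j =>
    integrable_of_abs_le ((hdm j).mul (hDm j)) fun y => abs_mul_le_mul_of_abs_le (hdb j y) (hDb j y)
  have hTsum : ∀ y, T y = ∑ j, d j y * D j y := fun y => rfl
  -- With F the identity, the covariance formula computes the variance itself.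
  have hTmean : ∫ y, T y ∂Q = σ ^ 2 := by
    have hc := covariance_comp_volumeOn (n := n) hM ν (F := id) continuous_id
    simp only [id, sub_sub_cancel] at hc
    rw [← hm] at hc
    rw [hvar, hc]
    exact integral_finsetSum _ fun j _ => hdDi j
  have hconc : ∫ y, |T y - σ ^ 2| ∂Q ≤ √n * (14 * M ^ 2) := by
    rw [← hTmean]
    exact integral_abs_sub_integral_le_of_bounded_differences (ν.prod ν) hTm (abs_varStat_le hM)
      (by positivity) (abs_varStat_sub_update_le hM)
  obtain ⟨B, hB⟩ := isCompact_Icc.exists_bound_of_continuousOn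
    (s := Set.Icc ((-(n * M) - m) / σ) ((n * M - m) / σ)) hf.continuousOn
  have hfB : ∀ x, |f (w x)| ≤ B := fun x => by
    have := abs_le.1 (abs_volumeOn_le hM Set.univ x)
    exact hB _ ⟨by simp only [hw]; gcongr; exact this.1, by simp only [hw]; gcongr; exact this.2⟩
  have hfi : Integrable (fun x => f (w x)) (Measure.pi fun _ => ν) :=
    integrable_of_abs_le (hf.measurable.comp hwm) hfB
  have hfVi : Integrable (fun x => f (w x) * V x) (Measure.pi fun _ => ν) :=
    integrable_of_abs_le ((hf.measurable.comp hwm).mul hVm)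
      fun x => abs_mul_le_mul_of_abs_le (hfB x) (abs_volumeOn_le hM _ x)
  have hf'i : Integrable (fun x => f' (w x)) (Measure.pi fun _ => ν) :=
    integrable_of_abs_le (hf'.measurable.comp hwm) fun x => hbound _
  have hwfi : Integrable (fun x => w x * f (w x)) (Measure.pi fun _ => ν) := by
    have := (hfVi.sub (hfi.const_mul m)).div_const σ
    refine this.congr (ae_of_all _ fun x => ?_)
    simp only [hw, Pi.sub_apply]
    ring
  have hleft : (∫ x, h (w x) ∂Measure.pi fun _ : Fin n => ν) - ∫ t, h t ∂gaussianReal 0 1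
      = (∫ x, f' (w x) ∂Measure.pi fun _ : Fin n => ν)
        - ∫ x, w x * f (w x) ∂Measure.pi fun _ : Fin n => ν := by
    rw [← integral_sub hf'i hwfi]
    have hc : ∀ x, h (w x) = (f' (w x) - w x * f (w x)) + ∫ t, h t ∂gaussianReal 0 1 :=
      fun x => by rw [← hstein]; ring
    simp_rw [hc]
    have hi : Integrable (fun x => f' (w x) - w x * f (w x)) (Measure.pi fun _ => ν) :=
      hf'i.sub hwfi
    rw [integral_add hi (integrable_const _)]
    simp
  set g : Fin n → (Fin n → 𝒳 × 𝒳) → ℝ := fun j y =>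
    f (w (mix 0 y)) - f (w (mix 0 y) - d j y / σ) with hg
  have hcov : ∫ x, w x * f (w x) ∂Measure.pi (fun _ : Fin n => ν)
      = 1 / σ * ∑ j, ∫ y, g j y * D j y ∂Q := by
    have hc := covariance_comp_volumeOn (n := n) hM ν (F := fun v => f ((v - m) / σ))
      (hf.comp ((continuous_id.sub continuous_const).div_const σ))
    rw [← hm] at hc
    have h1 : ∀ j, ∫ y, g j y * D j y ∂Q = ∫ y, (f ((V (mix 0 y) - m) / σ)
        - f ((V (mix 0 y) - exposed l ε j (mix 0 y) - m) / σ)) * D j y ∂Q := fun j => by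
      refine integral_congr_ae (ae_of_all _ fun y => ?_)
      simp only [hg, hw, hd]
      congr 4
      ring
    rw [Finset.sum_congr rfl fun j _ => h1 j, ← hc, mul_comm _ m, ← integral_const_mul m,
      ← integral_sub hfVi (hfi.const_mul m), ← integral_const_mul]
    refine integral_congr_ae (ae_of_all _ fun x => ?_)
    simp only [hw]
    ring
  have hf'Qi : Integrable (fun y => f' (w (mix 0 y))) Q :=
    integrable_of_abs_le (hf'.measurable.comp (hwm.comp (measurable_mix 0))) fun y => hbound _
  have hf'dD : ∀ j, Integrable (fun y => f' (w (mix 0 y)) * (d j y / σ) * D j y) Q := fun j =>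
    integrable_of_abs_le (C := 4 * (M / σ) * M) (((hf'.measurable.comp (hwm.comp
      (measurable_mix 0))).mul ((hdm j).div_const σ)).mul (hDm j)) fun y =>
        abs_mul_le_mul_of_abs_le (abs_mul_le_mul_of_abs_le (hbound _)
          (by rw [abs_div, abs_of_pos hσ]; gcongr; exact hdb j y)) (hDb j y)
  -- Taylor costs (d_j/σ)² ≤ M²/σ² pointwise; the remaining factor D_j is averaged, giving M/2
  -- instead of M.
  have hrem : ∀ j, |(∫ y, g j y * D j y ∂Q) - ∫ y, f' (w (mix 0 y)) * (d j y / σ) * D j y ∂Q|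
      ≤ M ^ 3 / (2 * σ ^ 2) := by
    intro j
    have hpt : ∀ y, |g j y - f' (w (mix 0 y)) * (d j y / σ)| ≤ M ^ 2 / σ ^ 2 := fun y => by
      refine (htaylor _ _ (div_nonneg (exposed_nonneg _ _) hσ.le)).trans ?_
      rw [div_pow]
      gcongr
      · exact exposed_nonneg _ _
      · exact exposed_le hM _ _
    have hgm : Measurable (g j) := (hf.measurable.comp (hwm.comp (measurable_mix 0))).sub
      (hf.measurable.comp ((hwm.comp (measurable_mix 0)).sub ((hdm j).div_const σ)))
    have hdiff : Measurable fun y => g j y - f' (w (mix 0 y)) * (d j y / σ) :=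
      hgm.sub ((hf'.measurable.comp (hwm.comp (measurable_mix 0))).mul ((hdm j).div_const σ))
    have hgi : Integrable (fun y => g j y * D j y) Q := by
      have hi : Integrable (fun y => (g j y - f' (w (mix 0 y)) * (d j y / σ)) * D j y) Q :=
        integrable_of_abs_le (hdiff.mul (hDm j)) fun y =>
          abs_mul_le_mul_of_abs_le (hpt y) (hDb j y)
      refine (hi.add (hf'dD j)).congr (ae_of_all _ fun y => ?_)
      simp only [Pi.add_apply]
      ring
    rw [← integral_sub hgi (hf'dD j), ← Real.norm_eq_abs]
    have hDi : Integrable (fun y => M ^ 2 / σ ^ 2 * |D j y|) Q :=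
      (integrable_of_abs_le (hDm j) (hDb j)).abs.const_mul _
    refine (norm_integral_le_of_norm_le hDi (ae_of_all _ fun y => ?_)).trans ?_
    · rw [← sub_mul, Real.norm_eq_abs]
      exact abs_mul_le_mul_of_abs_le (hpt y) le_rfl |>.trans_eq (by simp)
    · rw [integral_const_mul]
      calc M ^ 2 / σ ^ 2 * ∫ y, |D j y| ∂Q ≤ M ^ 2 / σ ^ 2 * (M / 2) := by
            gcongr
            exact integral_abs_exposed_mix_sub_le hM ν j
        _ = M ^ 3 / (2 * σ ^ 2) := by field_simp
  have hmain : ∑ j, ∫ y, f' (w (mix 0 y)) * (d j y / σ) * D j y ∂Q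
      = 1 / σ * ∫ y, f' (w (mix 0 y)) * T y ∂Q := by
    rw [← integral_finsetSum _ fun j _ => hf'dD j, ← integral_const_mul]
    refine integral_congr_ae (ae_of_all _ fun y => ?_)
    simp only [hTsum, Finset.mul_sum]
    exact Finset.sum_congr rfl fun j _ => by ring
  have hrem_sum : |(∑ j, ∫ y, g j y * D j y ∂Q) - 1 / σ * ∫ y, f' (w (mix 0 y)) * T y ∂Q|
      ≤ n * (M ^ 3 / (2 * σ ^ 2)) := by
    rw [← hmain, ← Finset.sum_sub_distrib]
    refine (Finset.abs_sum_le_sum_abs _ _).trans ((Finset.sum_le_sum fun j _ => hrem j).trans_eq ?_)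
    rw [Finset.sum_const, Finset.card_univ, Fintype.card_fin, nsmul_eq_mul]
  have hf'Ti : Integrable (fun y => f' (w (mix 0 y)) * T y) Q :=
    integrable_of_abs_le ((hf'.measurable.comp (hwm.comp (measurable_mix 0))).mul hTm)
      fun y => abs_mul_le_mul_of_abs_le (hbound _) (abs_varStat_le hM y)
  have hfirst : |σ ^ 2 * (∫ x, f' (w x) ∂Measure.pi fun _ : Fin n => ν)
      - ∫ y, f' (w (mix 0 y)) * T y ∂Q| ≤ 56 * √n * M ^ 2 := by
    rw [← integral_comp_mix ν 0 (F := fun x => f' (w x)) (hf'.measurable.comp hwm),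
      ← integral_const_mul, ← integral_sub (hf'Qi.const_mul _) hf'Ti, ← Real.norm_eq_abs]
    have hTi' : Integrable (fun y => 4 * |T y - σ ^ 2|) Q :=
      ((hTi.sub (integrable_const _)).abs).const_mul 4
    refine (norm_integral_le_of_norm_le hTi' (ae_of_all _ fun y => ?_)).trans ?_
    · rw [Real.norm_eq_abs, show σ ^ 2 * f' (w (mix 0 y)) - f' (w (mix 0 y)) * T y
        = -(f' (w (mix 0 y)) * (T y - σ ^ 2)) by ring, abs_neg]
      exact abs_mul_le_mul_of_abs_le (hbound _) le_rfl
    · rw [integral_const_mul]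
      linarith
  rw [hleft, hcov]
  set I₁ := ∫ x, f' (w x) ∂Measure.pi fun _ : Fin n => ν
  set I₂ := ∫ y, f' (w (mix 0 y)) * T y ∂Q
  set S := ∑ j, ∫ y, g j y * D j y ∂Q
  -- The first part is the fluctuation of T about σ², weighted by f'; the second is the accumulated
  -- Taylor remainder.
  have hdecomp : I₁ - 1 / σ * S = (σ ^ 2 * I₁ - I₂) / σ ^ 2 - (S - 1 / σ * I₂) / σ := by
    field_simp
    ring
  rw [hdecomp]
  refine (abs_sub _ _).trans (add_le_add ?_ ?_)
  · rw [abs_div, abs_of_pos (pow_pos hσ 2)]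
    gcongr
  · rw [abs_div, abs_of_pos hσ, div_le_iff₀ hσ]
    refine hrem_sum.trans_eq ?_
    field_simp

lemma gaussianDist_coveredVolume_le (hε : 0 < ε) (hM : maxBall l ε ≠ ⊤) (ν : Measure 𝒳)
    [IsProbabilityMeasure ν] {Ω : Type*} [MeasurableSpace Ω] (P : Measure Ω)
    [IsProbabilityMeasure P] {X : Fin n → Ω → 𝒳} {σ : ℝ} (hX : ∀ i, HasLaw (X i) ν P)
    (hind : iIndepFun X P) (hσ : 0 < σ) (hvar : σ ^ 2 = Var[coveredVolume l ε X; P]) :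
    gaussianDist P (coveredVolume l ε X) ≤ ENNReal.ofReal
      (56 * √n * (maxBall l ε).toReal ^ 2 / σ ^ 2
        + n * (maxBall l ε).toReal ^ 3 / (2 * σ ^ 3)) := by
  have := sigmaFinite_of_maxBall_ne_top hε hM
  have hmap : P.map (fun ω i => X i ω) = Measure.pi fun _ : Fin n => ν := by
    rw [hind.map_fun_eq_pi_map fun i => (hX i).aemeasurable]
    congr with i
    rw [(hX i).map_eq]
  have hXm : AEMeasurable (fun ω i => X i ω) P :=
    aemeasurable_pi_iff.2 fun i => (hX i).aemeasurable
  have hVm : Measurable fun x : Fin n → 𝒳 => volumeOn l ε Set.univ x := measurable_volumeOn _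
  have hW : coveredVolume l ε X = fun ω => volumeOn l ε Set.univ fun i => X i ω :=
    funext (coveredVolume_eq_volumeOn X)
  have htrans : ∀ {F : (Fin n → 𝒳) → ℝ}, Measurable F →
      ∫ ω, F (fun i => X i ω) ∂P = ∫ x, F x ∂Measure.pi fun _ : Fin n => ν := fun hF => by
    rw [← hmap, integral_map hXm hF.aestronglyMeasurable]
  have hmean : ∫ ω, coveredVolume l ε X ω ∂P
      = ∫ x, volumeOn l ε Set.univ x ∂Measure.pi fun _ : Fin n => ν := by
    rw [hW]
    exact htrans hVm
  have hWm : AEMeasurable (fun ω => volumeOn l ε Set.univ fun i => X i ω) P :=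
    hVm.comp_aemeasurable hXm
  have hmem : MemLp (coveredVolume l ε X) 2 P := by
    rw [hW]
    exact .of_bound hWm.aestronglyMeasurable (n * (maxBall l ε).toReal)
      (ae_of_all _ fun ω => abs_volumeOn_le hM _ _)
  have hvar' : σ ^ 2 = (∫ x, volumeOn l ε Set.univ x * volumeOn l ε Set.univ x
      ∂Measure.pi fun _ : Fin n => ν) - (∫ ω, coveredVolume l ε X ω ∂P)
        * ∫ ω, coveredVolume l ε X ω ∂P := by
    rw [hvar, variance_eq_sub hmem, ← htrans (F := fun x => volumeOn l ε Set.univ x *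
      volumeOn l ε Set.univ x) (hVm.mul hVm), hW]
    simp [sq]
  unfold gaussianDist wasserstein
  rw [← hvar, Real.sqrt_sq hσ.le]
  refine iSup₂_le fun h hh => ENNReal.ofReal_le_ofReal ?_
  rw [integral_map (by rw [hW]; exact (hWm.sub_const _).div_const σ)
    hh.continuous.aestronglyMeasurable]
  have := abs_integral_sub_gaussian_le hM ν hh hσ hmean hvar'
  rw [← htrans (F := fun x => h ((volumeOn l ε Set.univ x - ∫ ω, coveredVolume l ε X ω ∂P) / σ))
    (hh.continuous.measurable.comp ((hVm.sub_const _).div_const σ))] at this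
  simpa only [coveredVolume_eq_volumeOn] using this

end NormalApproximation

end CoverageCLT

/-! ### The bound in extended nonnegative reals -/

theorem proposition3p3 :
    ∃ C : ℝ≥0, ∀ (𝒳 : Type*) [MetricSpace 𝒳] [TopologicalSpace.SeparableSpace 𝒳]
      [MeasurableSpace 𝒳] [BorelSpace 𝒳] (l : Measure 𝒳)
      (ν : Measure 𝒳) [IsProbabilityMeasure ν]
      (Ω : Type*) [MeasurableSpace Ω] (P : Measure Ω) [IsProbabilityMeasure P]
      (n : ℕ) (X : Fin n → Ω → 𝒳) (ε σ : ℝ),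
      (∀ i, HasLaw (X i) ν P) → iIndepFun X P → 0 < ε →
      0 < σ → σ ^ 2 = Var[CoverageCLT.coveredVolume l ε X; P] →
      CoverageCLT.gaussianDist P (CoverageCLT.coveredVolume l ε X) ≤
        C * (n : ℝ≥0∞) ^ (1 / 2 : ℝ) * CoverageCLT.maxBall l ε ^ 2
            * (1 + n * CoverageCLT.closeProb ν ε) / ENNReal.ofReal σ ^ 2
          + n * CoverageCLT.maxBall l ε ^ 3 / (2 * ENNReal.ofReal σ ^ 3) := by
  -- 56 = 4 · 14: the bound on f' times the bounded-difference constant of T.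
  refine ⟨56, ?_⟩
  intro 𝒳 _ _ _ _ l ν _ Ω _ P _ n X ε σ hX hind hε hσ hvar
  have hone : (1 : ℝ≥0∞) ≤ 1 + n * CoverageCLT.closeProb ν ε := le_self_add
  have hmono : ((56 : ℝ≥0) : ℝ≥0∞) * (n : ℝ≥0∞) ^ (1 / 2 : ℝ) * CoverageCLT.maxBall l ε ^ 2
        / ENNReal.ofReal σ ^ 2 + n * CoverageCLT.maxBall l ε ^ 3 / (2 * ENNReal.ofReal σ ^ 3)
      ≤ ((56 : ℝ≥0) : ℝ≥0∞) * (n : ℝ≥0∞) ^ (1 / 2 : ℝ) * CoverageCLT.maxBall l ε ^ 2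
            * (1 + n * CoverageCLT.closeProb ν ε) / ENNReal.ofReal σ ^ 2
          + n * CoverageCLT.maxBall l ε ^ 3 / (2 * ENNReal.ofReal σ ^ 3) := by
    gcongr ?_ / _ + _
    exact le_mul_of_one_le_right zero_le hone
  refine le_trans ?_ hmono
  by_cases hM : CoverageCLT.maxBall l ε = ⊤
  -- For n = 0 the product n · ∞ would be 0 in `ℝ≥0∞`; positivity of the variance rules this case
  -- out.
  · have hn : n ≠ 0 := by
      rintro rfl
      rw [CoverageCLT.variance_coveredVolume_zero] at hvar
      exact (pow_pos hσ 2).ne' hvar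
    have hn' : (n : ℝ≥0∞) ≠ 0 := by exact_mod_cast hn
    have htop : (n : ℝ≥0∞) * CoverageCLT.maxBall l ε ^ 3 / (2 * ENNReal.ofReal σ ^ 3) = ⊤ := by
      rw [hM, ENNReal.top_pow (by norm_num), ENNReal.mul_top hn',
        ENNReal.top_div_of_ne_top (by finiteness)]
    rw [htop, add_top]
    exact le_top
  · refine (CoverageCLT.gaussianDist_coveredVolume_le hε hM ν P hX hind hσ hvar).trans_eq ?_
    rw [ENNReal.ofReal_add (by positivity) (by positivity), ENNReal.ofReal_div_of_pos (by positivity),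
      ENNReal.ofReal_div_of_pos (by positivity)]
    have hMr : ENNReal.ofReal (CoverageCLT.maxBall l ε).toReal = CoverageCLT.maxBall l ε :=
      ENNReal.ofReal_toReal hM
    have hsqrt : ENNReal.ofReal √n = (n : ℝ≥0∞) ^ (1 / 2 : ℝ) := by
      rw [Real.sqrt_eq_rpow, ← ENNReal.ofReal_rpow_of_nonneg (by positivity) (by norm_num),
        ENNReal.ofReal_natCast]
    simp only [ENNReal.ofReal_mul, ENNReal.ofReal_pow, Real.sqrt_nonneg, ENNReal.toReal_nonneg,
      hσ.le, Nat.cast_nonneg, Nat.ofNat_nonneg, mul_nonneg, hMr, hsqrt, ENNReal.ofReal_natCast,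
      ENNReal.ofReal_ofNat, ENNReal.coe_ofNat]
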